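/- For $\varepsilon=\pm1$ let $I_\varepsilon$ be a set with at least two elements, with a distinguished point $\iota_\varepsilon$, put $I'_\varepsilon=I_\varepsilon\setminus\{\iota_\varepsilon\}$, and let $\Sigma_\varepsilon\le\mathrm{Sym}(I_\varepsilon)$ be a transitive permutation group. Let $\Gamma=\Sigma_{-1}\times\Sigma_1$ act on $I_{-1}\sqcup I_1$, and let $\Gamma_\varepsilon$ be the stabilizer of $\iota_\varepsilon$ in $\Gamma$. A word $(i_1,\varepsilon_1,\dots,i_n,\varepsilon_n)$, $n\ge0$, with $\varepsilon_t=\pm1$ and $i_t\in I_{-\varepsilon_t}$, is called admissible if $i_t\in I'_{-\varepsilon_t}$ whenever $\varepsilon_t\varepsilon_{t-1}=-1$. Let $\Lambda=\Lambda[\Sigma_{-1},\Sigma_1]$ be the group generated by $\tau$, by the symbols $h(\sigma)$ ($\sigma\in\Gamma$), and by the symbols $h(w;\sigma)$, where $w=(i_1,\varepsilon_1,\dots,i_n,\varepsilon_n)$ is an admissible word with $n\ge1$ and $\sigma\in\Gamma_{\varepsilon_n}$, subject to the following relations (for all admissible words and permutations for which the symbols are defined; $w,w'$ are non-empty, $u$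 may be empty, and $h(\emptyset;\sigma)=h(\sigma)$): 1. $h(\sigma)h(\sigma')=h(\sigma\sigma')$ and $h(w;\sigma)h(w;\sigma')=h(w;\sigma\sigma')$; in particular $h(\sigma_{-1})$ and $h(\sigma_1)$ commute for $\sigma_{\pm1}\in\Sigma_{\pm1}$; 2. $h(w';\sigma')$ and $h(wu;\sigma)$ commute if $w,w'$ have the same length and $w\ne w'$; 3. $h(w;\sigma)\,h(w,i,\varepsilon,u;\sigma')\,h(w;\sigma)^{-1}=h(w,\sigma(i),\varepsilon,u;\sigma')$ and $h(\sigma)\,h(i,\varepsilon,u;\sigma')\,h(\sigma)^{-1}=h(\sigma(i),\varepsilon,u;\sigma')$; 4. $\tau^{\varepsilon}h(\sigma)\tau^{-\varepsilon}=h(\iota_{-\varepsilon},\varepsilon;\sigma)$ for $\sigma\in\Gamma_\varepsilon$, and $\tau^{\varepsilon}h(i,\varepsilon,u;\sigma)\tau^{-\varepsilon}=h(\iota_{-\varepsilon},\varepsilon,i,\varepsilon,u;\sigma)$; 5. $\tau^{-\varepsilon}h(i,\varepsilon,u;\sigma)\tau^{\varepsilon}$ equals $h(u;\sigma)$ if $i=\iota_{-\varepsilon}$,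 and $h(\iota_\varepsilon,-\varepsilon,i,\varepsilon,u;\sigma)$ if $i\ne\iota_{-\varepsilon}$. Equivalently, $\Lambda$ is the HNN-extension $\langle G,\tau\mid\tau^{-1}h\tau=\theta(h),\ h\in H\rangle$, where $G$ is generated by all the symbols $h$, $H$ is generated by the $h(w;\sigma)$ and the $h(\sigma)$ with $\sigma\in\Gamma_{-1}$, and $\theta$ is given by relations 4 and 5. Assume that (i) $\Sigma_{-1}$ and $\Sigma_1$ are $2$-transitive, that is, for $\varepsilon=\pm1$ and every $i\in I_\varepsilon$ the stabilizer $(\Sigma_\varepsilon)_i$ is transitive on $I_\varepsilon\setminus\{i\}$; (ii) for each $\varepsilon=\pm1$, either $\Sigma_\varepsilon$ is generated by its point stabilizers $(\Sigma_\varepsilon)_i$, $i\in I_\varepsilon$, or $\Sigma_\varepsilon=\mathrm{Sym}(2)$ (that is, $|I_\varepsilon|=2$ and $\Sigma_\varepsilon=\mathrm{Sym}(I_\varepsilon)$). Then $\Lambda$ has a simple normal subgroup $\Xi$ for which there is a group extension $$1\longrightarrow\Xi\longrightarrow\Lambda\overset{\eta}{\longrightarrow}(\Gamma/[\Gamma,\Gamma])\wr_{\mathbb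 Z}\mathbb Z\longrightarrow1,$$ where the right-hand group is the restricted wreath product $\bigl(\bigoplus_{\mathbb Z}\Gamma/[\Gamma,\Gamma]\bigr)\rtimes\mathbb Z$, the generator $1$ of $\mathbb Z$ moving the entry in position $m$ to position $m+1$. Here $\eta(\tau)$ is the generator $1$ of $\mathbb Z$, $\eta(h(\sigma))$ is the class $[\sigma]$ in position $0$, and $\eta(h(i_1,\varepsilon_1,\dots,i_n,\varepsilon_n;\sigma_n))$ is the class $[\sigma_n]$ in position $\varepsilon_1+\dots+\varepsilon_n$ (with all other entries trivial and trivial component in $\mathbb Z$). -/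

import Mathlib

universe u

namespace TreeHNN

section Combinatorics

variable {I : ℤˣ → Type u} (ι : ∀ ε, I ε) (S : ∀ ε, Subgroup (Equiv.Perm (I ε)))

/-- The group `Γ = Σ₋₁ · Σ₁`: the product of the two permutation groups, the factor `Σ_ε`
acting on the summand `I_ε` of `I₋₁ ⊔ I₁`. Signs `ε = ±1` are elements of `ℤˣ`. -/
abbrev Gam : Type u := ∀ ε : ℤˣ, S ε

/-- `Γ_ε`, the stabilizer in `Γ` of the point `ι_ε`. -/
def gamStab (ε : ℤˣ) : Subgroup (Gam S) :=
  (MulAction.stabilizer (S ε) (ι ε)).comap (Pi.evalMonoidHom (fun ε : ℤˣ => S ε) ε)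

/-- A letter `(i_t, ε_t)`: a sign `ε_t` together with an index `i_t ∈ I_{-ε_t}`. -/
abbrev Letter (I : ℤˣ → Type u) : Type u := Σ ε : ℤˣ, I (-ε)

/-- The condition on `(i_1, ε_1, …, i_n, ε_n)`: whenever `ε_t ε_{t-1} = -1`, the index `i_t`
lies in `I'_{-ε_t}`, that is, `i_t ≠ ι_{-ε_t}`. -/
def Admissible (w : List (Letter I)) : Prop :=
  w.IsChain fun a b => b.1 * a.1 = -1 → b.2 ≠ ι (-b.1)

/-- The group of the admissible `σ` in a symbol `h(w; σ)`: it is `Γ_{ε_n}` for a word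
`w = (i_1, ε_1, …, i_n, ε_n)` with `n ≥ 1`, and all of `Γ` for the empty word. -/
def label (w : List (Letter I)) : Subgroup (Gam S) :=
  match w.getLast? with
  | none => ⊤
  | some a => gamStab ι S a.1

/-- The symbols `h(i_1, ε_1, …, i_n, ε_n; σ_n)` with `n ≥ 1`, and the symbols `h(σ)`, which
are those with the empty word. -/
structure Symb where
  word : List (Letter I)
  perm : Gam S
  reduced : Admissible ι word
  mem : perm ∈ label ι S word

/-- The generators of `Λ`: the stable letter `τ` and the symbols `h`. -/
inductive Gen
  | tau : Gen
  | symb (x : Symb ι S) : Gen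

/-- The stable letter `τ` in the free group. -/
def fτ : FreeGroup (Gen ι S) := FreeGroup.of Gen.tau

/-- The generator `h(w; σ)` in the free group. -/
def fh (w : List (Letter I)) (σ : Gam S) (hw : Admissible ι w) (hσ : σ ∈ label ι S w) :
    FreeGroup (Gen ι S) :=
  FreeGroup.of (Gen.symb ⟨w, σ, hw, hσ⟩)

/-- The generator `h(σ)`, `σ ∈ Γ`, in the free group. -/
def fh₀ (σ : Gam S) : FreeGroup (Gen ι S) :=
  fh ι S [] σ List.isChain_nil (Subgroup.mem_top σ)

/-- The defining relations `l = r` of `Λ`. Relations `r1`–`r6` are those of the base group `G`;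
relations `r7`–`r9` say that `τ⁻¹ h τ = θ(h)` for the generators `h` of `H`. Hypotheses of the
form `Admissible _ _` and `_ ∈ label _ _ _` only say that the symbols written down exist. -/
inductive Rel : FreeGroup (Gen ι S) → FreeGroup (Gen ι S) → Prop
  | r1 (s : S (-1)) (t : S 1) :
      Rel (fh₀ ι S (Pi.mulSingle (-1) s) * fh₀ ι S (Pi.mulSingle 1 t))
        (fh₀ ι S (Pi.mulSingle 1 t) * fh₀ ι S (Pi.mulSingle (-1) s))
  | r2 (v w u : List (Letter I)) (σ σ' : Gam S) (hv hσ' hwu hσ)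
      (hne : v ≠ []) (hlen : v.length = w.length) (hvw : v ≠ w) :
      Rel (fh ι S v σ' hv hσ' * fh ι S (w ++ u) σ hwu hσ)
        (fh ι S (w ++ u) σ hwu hσ * fh ι S v σ' hv hσ')
  | r3 (w u : List (Letter I)) (ε : ℤˣ) (i : I (-ε)) (σ σ' : Gam S) (hw hσ h₁ hσ' h₂ hσ'₂)
      (hne : w ≠ []) :
      Rel (fh ι S w σ hw hσ * fh ι S (w ++ ⟨ε, i⟩ :: u) σ' h₁ hσ' * (fh ι S w σ hw hσ)⁻¹)
        (fh ι S (w ++ ⟨ε, (σ (-ε) : Equiv.Perm (I (-ε))) i⟩ :: u) σ' h₂ hσ'₂)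
  | r4 (w : List (Letter I)) (σ σ' : Gam S) (hw hσ hσ' hσσ') (hne : w ≠ []) :
      Rel (fh ι S w σ hw hσ * fh ι S w σ' hw hσ') (fh ι S w (σ * σ') hw hσσ')
  | r5 (σ σ' : Gam S) :
      Rel (fh₀ ι S σ * fh₀ ι S σ') (fh₀ ι S (σ * σ'))
  | r6 (u : List (Letter I)) (ε : ℤˣ) (i : I (-ε)) (σ σ' : Gam S) (h₁ hσ' h₂ hσ'₂) :
      Rel (fh₀ ι S σ * fh ι S (⟨ε, i⟩ :: u) σ' h₁ hσ' * (fh₀ ι S σ)⁻¹)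
        (fh ι S (⟨ε, (σ (-ε) : Equiv.Perm (I (-ε))) i⟩ :: u) σ' h₂ hσ'₂)
  | r7 (ε : ℤˣ) (σ : Gam S) (h₁ hσ) :
      Rel (fτ ι S ^ (ε : ℤ) * fh₀ ι S σ * fτ ι S ^ (-ε : ℤ))
        (fh ι S [⟨ε, ι (-ε)⟩] σ h₁ hσ)
  | r8 (ε : ℤˣ) (i : I (-ε)) (u : List (Letter I)) (σ : Gam S) (h₁ hσ h₂ hσ₂) :
      Rel (fτ ι S ^ (ε : ℤ) * fh ι S (⟨ε, i⟩ :: u) σ h₁ hσ * fτ ι S ^ (-ε : ℤ))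
        (fh ι S (⟨ε, ι (-ε)⟩ :: ⟨ε, i⟩ :: u) σ h₂ hσ₂)
  | r9_eq (ε : ℤˣ) (u : List (Letter I)) (σ : Gam S) (h₁ hσ h₂ hσ₂) :
      Rel (fτ ι S ^ (-ε : ℤ) * fh ι S (⟨ε, ι (-ε)⟩ :: u) σ h₁ hσ * fτ ι S ^ (ε : ℤ))
        (fh ι S u σ h₂ hσ₂)
  | r9_ne (ε : ℤˣ) (i : I (-ε)) (u : List (Letter I)) (σ : Gam S) (h₁ hσ h₂ hσ₂)
      (hi : i ≠ ι (-ε)) :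
      Rel (fτ ι S ^ (-ε : ℤ) * fh ι S (⟨ε, i⟩ :: u) σ h₁ hσ * fτ ι S ^ (ε : ℤ))
        (fh ι S (⟨-ε, ι (-(-ε))⟩ :: ⟨ε, i⟩ :: u) σ h₂ hσ₂)

/-- The set of relators. -/
def rels : Set (FreeGroup (Gen ι S)) := {r | ∃ a b, Rel ι S a b ∧ r = a * b⁻¹}

/-- The group `Λ = Λ[I₋₁, I₁, ι₋₁, ι₁; Σ₋₁, Σ₁]`, in the presentation that defines the
HNN-extension `HNN(G, H, θ) = ⟨G, τ ∣ τ⁻¹ h τ = θ(h), h ∈ H⟩`. See `equivHNN` below for its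
identification with Mathlib's HNN-extension of `G` along `θ`. -/
abbrev Lam : Type u := PresentedGroup (rels ι S)

/-- The stable letter `τ ∈ Λ`. -/
def τ : Lam ι S := PresentedGroup.of Gen.tau

/-- The generator `h(i_1, ε_1, …, i_n, ε_n; σ_n) ∈ Λ`. -/
def h (x : Symb ι S) : Lam ι S := PresentedGroup.of (Gen.symb x)

/-- The generator `h(σ) ∈ Λ`, `σ ∈ Γ`. -/
def h₀ (σ : Gam S) : Lam ι S := h ι S ⟨[], σ, List.isChain_nil, Subgroup.mem_top σ⟩

/-- The integer `ε_1 + ⋯ + ε_n` of the word `(i_1, ε_1, …, i_n, ε_n)`. -/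
def height (w : List (Letter I)) : ℤ := (w.map fun a => (a.1 : ℤ)).sum

end Combinatorics

section HNN

variable {I : ℤˣ → Type u} (ι : ∀ ε, I ε) (S : ∀ ε, Subgroup (Equiv.Perm (I ε)))

/-- The subgroup `G = ⟨{h(i_1, ε_1, …, i_n, ε_n; σ_n)} ∪ {h(σ) ∣ σ ∈ Γ}⟩` of `Λ`. -/
def base : Subgroup (Lam ι S) := Subgroup.closure (Set.range (h ι S))

/-- The generators of `H_ε`: all `h(i_1, ε_1, …, i_n, ε_n; σ_n)` with `n ≥ 1`, and the
`h(σ)` with `σ ∈ Γ_ε`. -/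
def edgeGen (ε : ℤˣ) : Set (Symb ι S) := {x | x.word = [] → x.perm ∈ gamStab ι S ε}

/-- The subgroup `H_ε` of `G`; thus `H = H₋₁` and `θ(H) = H₁`. -/
def edge (ε : ℤˣ) : Subgroup (Lam ι S) := Subgroup.closure (h ι S '' edgeGen ι S ε)

variable {ι S}

theorem of_rel {a b : FreeGroup (Gen ι S)} (hab : Rel ι S a b) :
    PresentedGroup.mk (rels ι S) a = PresentedGroup.mk (rels ι S) b :=
  PresentedGroup.mk_eq_mk_of_mul_inv_mem ⟨a, b, hab, rfl⟩

theorem h_mem_base (x : Symb ι S) : h ι S x ∈ base ι S :=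
  Subgroup.subset_closure ⟨x, rfl⟩

theorem edge_le_base (ε : ℤˣ) : edge ι S ε ≤ base ι S :=
  Subgroup.closure_mono (Set.image_subset_range _ _)

theorem h_mem_edge {ε : ℤˣ} {x : Symb ι S} (hx : x ∈ edgeGen ι S ε) : h ι S x ∈ edge ι S ε :=
  Subgroup.subset_closure ⟨x, hx, rfl⟩

theorem sign_mul_self_ne (ε : ℤˣ) : ε * ε ≠ -1 := by
  rw [Int.units_mul_self]
  decide

/-- `τ^ε H_ε τ^{-ε} ⊆ H_{-ε}`, on generators. -/
theorem conj_gen_mem {ε : ℤˣ} {x : Symb ι S} (hx : x ∈ edgeGen ι S ε) :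
    τ ι S ^ (ε : ℤ) * h ι S x * τ ι S ^ (-ε : ℤ) ∈ edge ι S (-ε) := by
  obtain ⟨w, σ, hw, hσ⟩ := x
  rcases w with _ | ⟨⟨e, i⟩, u⟩
  · have hσ' : σ ∈ label ι S [(⟨ε, ι (-ε)⟩ : Letter I)] := hx rfl
    have h₁ : Admissible ι [(⟨ε, ι (-ε)⟩ : Letter I)] := List.isChain_singleton _
    have key : τ ι S ^ (ε : ℤ) * h ι S ⟨[], σ, hw, hσ⟩ * τ ι S ^ (-ε : ℤ)
        = h ι S ⟨_, σ, h₁, hσ'⟩ := of_rel (Rel.r7 ε σ h₁ hσ')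
    rw [key]
    exact h_mem_edge fun hnil => by simp at hnil
  · rcases Int.units_eq_one_or (e * ε) with he | he
    · obtain rfl : e = ε := by
        rw [← mul_one e, ← Int.units_mul_self ε, ← mul_assoc, he, one_mul]
      have h₂ : Admissible ι ((⟨e, ι (-e)⟩ : Letter I) :: ⟨e, i⟩ :: u) :=
        List.isChain_cons_cons.2 ⟨fun hc => absurd hc (sign_mul_self_ne e), hw⟩
      have hσ₂ : σ ∈ label ι S ((⟨e, ι (-e)⟩ : Letter I) :: ⟨e, i⟩ :: u) := by
        simpa [label] using hσ
      have key : τ ι S ^ (e : ℤ) * h ι S ⟨_, σ, hw, hσ⟩ * τ ι S ^ (-e : ℤ)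
          = h ι S ⟨_, σ, h₂, hσ₂⟩ := of_rel (Rel.r8 e i u σ hw hσ h₂ hσ₂)
      rw [key]
      exact h_mem_edge fun hnil => by simp at hnil
    · obtain rfl : ε = -e := by
        rw [← mul_one ε, ← Int.units_mul_self e, mul_comm, mul_assoc, he, mul_neg, mul_one]
      simp only [Units.val_neg, neg_neg]
      by_cases hi : i = ι (-e)
      · subst hi
        have h₂ : Admissible ι u := List.IsChain.of_cons hw
        have hσ₂ : σ ∈ label ι S u := by
          rcases u with _ | ⟨b, u⟩
          · exact Subgroup.mem_top σ
          · simpa [label] using hσ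
        have key : τ ι S ^ (-e : ℤ) * h ι S ⟨_, σ, hw, hσ⟩ * τ ι S ^ (e : ℤ)
            = h ι S ⟨_, σ, h₂, hσ₂⟩ := of_rel (Rel.r9_eq e u σ hw hσ h₂ hσ₂)
        rw [key]
        refine h_mem_edge fun hnil => ?_
        obtain rfl : u = [] := hnil
        exact hσ
      · have h₂ : Admissible ι ((⟨-e, ι (-(-e))⟩ : Letter I) :: ⟨e, i⟩ :: u) :=
          List.isChain_cons_cons.2 ⟨fun _ => hi, hw⟩
        have hσ₂ : σ ∈ label ι S ((⟨-e, ι (-(-e))⟩ : Letter I) :: ⟨e, i⟩ :: u) := by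
          simpa [label] using hσ
        have key : τ ι S ^ (-e : ℤ) * h ι S ⟨_, σ, hw, hσ⟩ * τ ι S ^ (e : ℤ)
            = h ι S ⟨_, σ, h₂, hσ₂⟩ := of_rel (Rel.r9_ne e i u σ hw hσ h₂ hσ₂ hi)
        rw [key]
        exact h_mem_edge fun hnil => by simp at hnil

/-- `τ^ε H_ε τ^{-ε} ⊆ H_{-ε}`. -/
theorem conj_mem {ε : ℤˣ} {g : Lam ι S} (hg : g ∈ edge ι S ε) :
    τ ι S ^ (ε : ℤ) * g * τ ι S ^ (-ε : ℤ) ∈ edge ι S (-ε) := by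
  have hle : edge ι S ε ≤ (edge ι S (-ε)).comap (MulAut.conj (τ ι S ^ (ε : ℤ))).toMonoidHom := by
    refine (Subgroup.closure_le _).2 ?_
    rintro _ ⟨x, hx, rfl⟩
    have := conj_gen_mem hx
    rw [zpow_neg] at this
    exact this
  rw [zpow_neg]
  exact hle hg

variable (ι S)

/-- The isomorphism `θ : H = H₋₁ → H₁`, `θ(h) = τ⁻¹ h τ`; its values on the generators of `H`
are given by the relations `r7`–`r9`. -/
def θ : (edge ι S (-1)).subgroupOf (base ι S) ≃* (edge ι S 1).subgroupOf (base ι S) where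
  toFun a := ⟨⟨(τ ι S)⁻¹ * a * τ ι S, edge_le_base 1 (by
    simpa using conj_mem (Subgroup.mem_subgroupOf.1 a.2))⟩, Subgroup.mem_subgroupOf.2 (by
    simpa using conj_mem (Subgroup.mem_subgroupOf.1 a.2))⟩
  invFun b := ⟨⟨τ ι S * b * (τ ι S)⁻¹, edge_le_base (-1) (by
    simpa using conj_mem (Subgroup.mem_subgroupOf.1 b.2))⟩, Subgroup.mem_subgroupOf.2 (by
    simpa using conj_mem (Subgroup.mem_subgroupOf.1 b.2))⟩
  left_inv a := by
    ext
    simp [mul_assoc]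
  right_inv b := by
    ext
    simp [mul_assoc]
  map_mul' a b := by
    ext
    simp [mul_assoc]

/-- `HNN(G, H, θ) = ⟨G, τ ∣ τ⁻¹ h τ = θ(h), h ∈ H⟩`. Mathlib's convention for the stable letter
is `t a t⁻¹ = φ a`, whence the use of `φ = θ⁻¹ : H₁ → H₋₁`. -/
abbrev HNN : Type u := HNNExtension (base ι S) _ _ (θ ι S).symm

variable {ι S}

theorem t_conj {ε : ℤˣ} {g g' : Lam ι S} (hg : g ∈ edge ι S ε) (hb : g ∈ base ι S)
    (hb' : g' ∈ base ι S) (hgg : τ ι S ^ (ε : ℤ) * g * τ ι S ^ (-ε : ℤ) = g') :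
    (HNNExtension.t : HNN ι S) ^ (ε : ℤ) * HNNExtension.of ⟨g, hb⟩ *
      HNNExtension.t ^ (-ε : ℤ) = HNNExtension.of ⟨g', hb'⟩ := by
  subst hgg
  rcases Int.units_eq_one_or ε with rfl | rfl
  · have := HNNExtension.equiv_eq_conj (φ := (θ ι S).symm)
      ⟨⟨g, hb⟩, Subgroup.mem_subgroupOf.2 hg⟩
    simp only [Units.val_one, zpow_one, zpow_neg]
    exact this.symm
  · have := HNNExtension.equiv_symm_eq_conj (φ := (θ ι S).symm)
      ⟨⟨g, hb⟩, Subgroup.mem_subgroupOf.2 hg⟩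
    simp only [Units.val_neg, Units.val_one, zpow_one, zpow_neg, inv_inv]
    exact this.symm

/-- The images in `HNN(G, H, θ)` of the generators of `Λ`. -/
def toHNNGen : Gen ι S → HNN ι S
  | .tau => HNNExtension.t
  | .symb x => HNNExtension.of ⟨h ι S x, h_mem_base x⟩

theorem toHNN_rel {a b : FreeGroup (Gen ι S)} (hab : Rel ι S a b) :
    FreeGroup.lift toHNNGen a = FreeGroup.lift toHNNGen b := by
  have hr := of_rel hab
  cases hab with
  | r7 ε σ h₁ hσ =>
    simp only [map_mul, map_zpow, fτ, fh, fh₀, FreeGroup.lift_apply_of, toHNNGen]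
    exact t_conj (h_mem_edge (x := ⟨[], σ, _, _⟩) fun _ => hσ) _ _ hr
  | r8 ε i u σ h₁ hσ h₂ hσ₂ =>
    simp only [map_mul, map_zpow, fτ, fh, FreeGroup.lift_apply_of, toHNNGen]
    exact t_conj (h_mem_edge fun hnil => by simp at hnil) _ _ hr
  | r9_eq ε u σ h₁ hσ h₂ hσ₂ =>
    simp only [map_mul, map_zpow, fτ, fh, FreeGroup.lift_apply_of, toHNNGen]
    have := t_conj (ε := -ε) (g := h ι S ⟨_, σ, h₁, hσ⟩) (g' := h ι S ⟨_, σ, h₂, hσ₂⟩)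
      (h_mem_edge fun hnil => by simp at hnil) (h_mem_base _) (h_mem_base _)
      (by rw [Units.val_neg, neg_neg]; exact hr)
    simpa only [Units.val_neg, neg_neg] using this
  | r9_ne ε i u σ h₁ hσ h₂ hσ₂ hi =>
    simp only [map_mul, map_zpow, fτ, fh, FreeGroup.lift_apply_of, toHNNGen]
    have := t_conj (ε := -ε) (g := h ι S ⟨_, σ, h₁, hσ⟩) (g' := h ι S ⟨_, σ, h₂, hσ₂⟩)
      (h_mem_edge fun hnil => by simp at hnil) (h_mem_base _) (h_mem_base _)
      (by rw [Units.val_neg, neg_neg]; exact hr)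
    simpa only [Units.val_neg, neg_neg] using this
  | _ =>
    simp only [map_mul, map_inv, fh, fh₀, FreeGroup.lift_apply_of, toHNNGen]
    simp only [← map_mul, ← map_inv]
    exact congrArg _ (Subtype.ext hr)

variable (ι S)

/-- The group `Λ` is the HNN-extension `HNN(G, H, θ)`. -/
def equivHNN : Lam ι S ≃* HNN ι S :=
  MonoidHom.toMulEquiv
    (PresentedGroup.toGroup (f := toHNNGen) (by
      rintro _ ⟨a, b, hab, rfl⟩
      rw [map_mul, map_inv, toHNN_rel hab, mul_inv_cancel]))
    (HNNExtension.lift (base ι S).subtype (τ ι S) (by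
      intro a
      change τ ι S * (a : Lam ι S) = τ ι S * (a : Lam ι S) * (τ ι S)⁻¹ * τ ι S
      simp))
    (by
      refine PresentedGroup.ext fun x => ?_
      cases x <;> simp [toHNNGen] <;> rfl)
    (by
      refine HNNExtension.hom_ext ?_ ?_
      · ext ⟨g, hg⟩
        simp only [MonoidHom.comp_apply, HNNExtension.lift_of, MonoidHom.id_apply,
          Subgroup.subtype_apply]
        induction hg using Subgroup.closure_induction with
        | mem x hx =>
          obtain ⟨y, rfl⟩ := hx
          exact PresentedGroup.toGroup.of _
        | one => exact (map_one _).trans (map_one _).symm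
        | mul x y hx hy hx' hy' =>
          rw [map_mul, hx', hy', ← map_mul]
          rfl
        | inv x hx hx' =>
          rw [map_inv, hx', ← map_inv]
          rfl
      · simp only [MonoidHom.comp_apply, HNNExtension.lift_t, MonoidHom.id_apply]
        exact PresentedGroup.toGroup.of _)

end HNN

section Wreath

variable (A : Type u) [CommGroup A]

/-- Translation of finitely supported functions `ℤ → A`: the element `n` moves the entry in
position `m` to position `m + n`. -/
noncomputable def shift : Multiplicative ℤ →* MulAut (Multiplicative (ℤ →₀ Additive A)) where
  toFun n := AddEquiv.toMultiplicative (Finsupp.domCongr (Equiv.addRight n.toAdd))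
  map_one' := by
    ext f m
    simp [Finsupp.domCongr, ← Equiv.Perm.inv_def]
  map_mul' n k := by
    ext f m
    simp only [Finsupp.domCongr, ← Equiv.Perm.inv_def]
    simp only [AddEquiv.toMultiplicative, toAdd_mul]
    simp [← Equiv.Perm.inv_def]
    exact congrArg _ (by abel)

/-- The restricted wreath product `A ≀_ℤ ℤ = (⨁_ℤ A) ⋊ ℤ`, where `ℤ` acts by translation. -/
abbrev Wreath : Type u := Multiplicative (ℤ →₀ Additive A) ⋊[shift A] Multiplicative ℤ

variable {A}

/-- The element of `A ≀_ℤ ℤ` with entry `a` in position `m`, trivial entries in all other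
positions, and trivial component in `ℤ`. -/
noncomputable def Wreath.lamp (m : ℤ) (a : A) : Wreath A :=
  SemidirectProduct.inl (Multiplicative.ofAdd (Finsupp.single m (Additive.ofMul a)))

variable (A) in
/-- The generator `1` of the factor `ℤ` of `A ≀_ℤ ℤ`. -/
noncomputable def Wreath.gen : Wreath A :=
  SemidirectProduct.inr (Multiplicative.ofAdd 1)

end Wreath

end TreeHNN

/-!
The group `Λ` acts on a tree whose vertices are the admissible words. The symbol `h(w; σ)` permutes
the branches that leave the vertex `w` and does nothing else, while `τ` translates along an axis.
This action is faithful (`eq_one_of_smul`): the cosets of `G` correspond equivariantly to the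
vertices, so that the stabilizer of the root is `G`, and an element of `G` is a product of local
permutations, sorted by the length of the words, which can be read off from its action on longer
and longer words.

Collecting the classes of the local permutations by the height of the vertices gives the
homomorphism `η` to the wreath product, and `Ξ` is its kernel. The proof of simplicity uses the
half-trees obtained by cutting an edge, and the rigid stabilizers `rist B` of the elements supported
in a half-tree `B`. Rigid stabilizers of disjoint half-trees commute, and `η` maps the rigid
stabilizer of any half-tree onto the whole base group of the wreath product. Therefore `Ξ` can move
every half-tree into every other one (`IsHalfTree.exists_mem_ker_smul_subset`): move it by any
element of `Λ` that does not shift the height, and correct the value of `η` on the complement.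

Let `ristComm` be the subgroup generated by the commutators `⁅a, b⁆` with `a`, `b` in
`Ξ ∩ rist B` for a common half-tree `B`.

* It is contained in every non-trivial normal subgroup `N` of `Ξ` (`ristComm_le_of_normalized`).
  An element `n ≠ 1` of `N` moves some half-tree `B` off itself, hence `⁅a, b⁆ = ⁅⁅n, a⁻¹⁆, b⁆`
  lies in `N` for `a`, `b` supported in `B`, and every half-tree can be moved into `B` by `Ξ`.
* It is all of `Ξ` (`ker_eta_eq_ristComm`). Replacing `a` and `b` by products with inverses of
  disjoint conjugates shows that `rist B` is abelian modulo `ristComm` for every half-tree `B`, and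
  from this all conjugates of the `h(σ)` by powers of `τ` commute modulo `ristComm`. As `Λ` is
  generated by `τ` and the `h(σ)`, the quotient map modulo `ristComm` factors through the wreath
  product.
-/

namespace TreeHNN

section Words

variable {I : ℤˣ → Type u} (ι : ∀ ε, I ε) (S : ∀ ε, Subgroup (Equiv.Perm (I ε)))

/-! ### Letters and admissible words -/

/-- The distinguished letter `(ι_{-ε}, ε)` of sign `ε`. -/
def axisLetter (ε : ℤˣ) : Letter I := ⟨ε, ι (-ε)⟩

@[simp]
theorem axisLetter_fst (ε : ℤˣ) : (axisLetter ι ε).1 = ε := rfl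

theorem units_ne_neg (ε : ℤˣ) : ε ≠ -ε := by
  rcases Int.units_eq_one_or ε with rfl | rfl <;> decide

theorem axisLetter_neg_ne (ε : ℤˣ) : axisLetter ι (-ε) ≠ axisLetter ι ε := fun h =>
  units_ne_neg ε (congrArg Sigma.fst h).symm

variable {ι} in
theorem exists_letter_ne (hI : ∀ ε, ∃ i : I ε, i ≠ ι ε) (ε : ℤˣ) :
    ∃ a : Letter I, a.1 = ε ∧ a ≠ axisLetter ι ε := by
  obtain ⟨i, hi⟩ := hI (-ε)
  exact ⟨⟨ε, i⟩, rfl, fun h => hi (eq_of_heq (Sigma.mk.inj_iff.1 h).2)⟩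

/-- Backtracking means continuing a letter `a` by the distinguished letter of sign `-a.1`, so
a word is admissible if and only if it does not backtrack. -/
theorem admissible_iff {w : List (Letter I)} :
    Admissible ι w ↔ w.IsChain fun a b => b ≠ axisLetter ι (-a.1) := by
  have key : ∀ a b : Letter I,
      (b.1 * a.1 = -1 → b.2 ≠ ι (-b.1)) ↔ b ≠ axisLetter ι (-a.1) := by
    rintro ⟨ε, i⟩ ⟨δ, j⟩
    constructor
    · rintro h hb
      obtain ⟨rfl, hj⟩ := Sigma.mk.inj_iff.1 hb
      exact h (by rw [neg_mul, Int.units_mul_self]) (eq_of_heq hj)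
    · intro h hδ hj
      have hδ' : δ = -ε := by
        rw [← mul_one δ, ← Int.units_mul_self ε, ← mul_assoc, hδ, neg_one_mul]
      subst hδ'
      exact h (Sigma.ext rfl (heq_of_eq hj))
  simp only [Admissible, key]

theorem admissible_nil : Admissible ι ([] : List (Letter I)) := List.isChain_nil

variable {ι}

theorem admissible_singleton (a : Letter I) : Admissible ι [a] := List.isChain_singleton _

theorem admissible_cons {a : Letter I} {w : List (Letter I)} :
    Admissible ι (a :: w) ↔ (∀ b ∈ w.head?, b ≠ axisLetter ι (-a.1)) ∧ Admissible ι w := by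
  simp only [admissible_iff, List.isChain_cons]

variable (ι) in
theorem admissible_axisLetter_cons {ε : ℤˣ} {w : List (Letter I)} (hw : Admissible ι w)
    (h : ∀ b ∈ w.head?, b ≠ axisLetter ι (-ε)) : Admissible ι (axisLetter ι ε :: w) :=
  admissible_cons.2 ⟨h, hw⟩

/-! ### The local permutation of a word -/

/-- The action of `Γ` on the letters, `σ · (i, ε) = (σ i, ε)`. -/
def letterPerm : Gam S →* Equiv.Perm (Letter I) where
  toFun σ := Equiv.sigmaCongrRight fun ε => (σ (-ε) : Equiv.Perm (I (-ε)))
  map_one' := rfl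
  map_mul' _ _ := rfl

variable {S}

@[simp]
theorem letterPerm_fst (σ : Gam S) (a : Letter I) : (letterPerm S σ a).1 = a.1 := rfl

theorem letterPerm_mk (σ : Gam S) (ε : ℤˣ) (i : I (-ε)) :
    letterPerm S σ ⟨ε, i⟩ = ⟨ε, (σ (-ε) : Equiv.Perm (I (-ε))) i⟩ := rfl

theorem letterPerm_axisLetter_neg_iff {σ : Gam S} {ε : ℤˣ} :
    letterPerm S σ (axisLetter ι (-ε)) = axisLetter ι (-ε) ↔ σ ∈ gamStab ι S ε := by
  have key : letterPerm S σ (axisLetter ι (-ε)) = axisLetter ι (-ε) ↔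
      (σ (- -ε) : Equiv.Perm (I (- -ε))) (ι (- -ε)) = ι (- -ε) :=
    ⟨fun h => eq_of_heq (Sigma.mk.inj_iff.1 h).2, fun h => Sigma.ext rfl (heq_of_eq h)⟩
  rw [key, neg_neg]
  rfl

theorem letterPerm_injective : Function.Injective (letterPerm S) := by
  intro σ ρ h
  funext ε
  refine Subtype.ext (Equiv.ext fun i => ?_)
  obtain ⟨δ, rfl⟩ : ∃ δ : ℤˣ, ε = -δ := ⟨-ε, (neg_neg ε).symm⟩
  have := congrArg (fun f => f (⟨δ, i⟩ : Letter I)) h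
  exact eq_of_heq (Sigma.mk.inj_iff.1 this).2

theorem mem_label_nil (σ : Gam S) : σ ∈ label ι S [] := Subgroup.mem_top σ

theorem mem_label_singleton {σ : Gam S} {a : Letter I} :
    σ ∈ label ι S [a] ↔ letterPerm S σ (axisLetter ι (-a.1)) = axisLetter ι (-a.1) :=
  letterPerm_axisLetter_neg_iff.symm

theorem label_cons_cons (a b : Letter I) (w : List (Letter I)) :
    label ι S (a :: b :: w) = label ι S (b :: w) := by
  simp [label]

theorem label_cons_of_ne_nil (a : Letter I) {w : List (Letter I)} (hw : w ≠ []) :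
    label ι S (a :: w) = label ι S w := by
  obtain ⟨b, w, rfl⟩ := List.exists_cons_of_ne_nil hw
  exact label_cons_cons a b w

theorem label_cons_le (a : Letter I) (w : List (Letter I)) : label ι S (a :: w) ≤ label ι S w := by
  rcases eq_or_ne w [] with rfl | hw
  · exact le_top
  · rw [label_cons_of_ne_nil a hw]

/-- The label group of a word depends on the sign of the last letter only. -/
theorem label_append_letterPerm (ρ : Gam S) (w : List (Letter I)) (a : Letter I)
    (v : List (Letter I)) :
    label ι S (w ++ letterPerm S ρ a :: v) = label ι S (w ++ a :: v) := by
  rcases v.eq_nil_or_concat with rfl | ⟨v, b, rfl⟩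
  · simp [label]
  · simp only [label, List.concat_eq_append, ← List.cons_append, ← List.append_assoc,
      List.getLast?_concat]

open Classical in
/-- The action of the symbol `h(w; σ)` on words: it replaces the letter `a` after the prefix `w` by
`σ · a`, and it fixes the words which do not properly extend `w`. -/
noncomputable def localAct (σ : Gam S) :
    List (Letter I) → List (Letter I) → List (Letter I)
  | _, [] => []
  | [], b :: z => letterPerm S σ b :: z
  | a :: w, b :: z => if a = b then b :: localAct σ w z else b :: z

@[simp]
theorem localAct_nil_right (σ : Gam S) (w : List (Letter I)) : localAct σ w [] = [] := by
  cases w <;> rfl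

@[simp]
theorem localAct_nil_cons (σ : Gam S) (b : Letter I) (z : List (Letter I)) :
    localAct σ [] (b :: z) = letterPerm S σ b :: z := rfl

@[simp]
theorem localAct_cons_self (σ : Gam S) (a : Letter I) (w z : List (Letter I)) :
    localAct σ (a :: w) (a :: z) = a :: localAct σ w z := if_pos rfl

theorem localAct_cons_of_ne (σ : Gam S) {a b : Letter I} (h : a ≠ b) (w z : List (Letter I)) :
    localAct σ (a :: w) (b :: z) = b :: z := if_neg h

theorem localAct_one (w z : List (Letter I)) : localAct (1 : Gam S) w z = z := by
  induction w generalizing z with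
  | nil => cases z <;> simp
  | cons a w ih =>
    rcases z with _ | ⟨b, z⟩
    · simp
    · by_cases h : a = b
      · subst h
        simp [ih]
      · rw [localAct_cons_of_ne _ h]

theorem localAct_mul (σ ρ : Gam S) (w z : List (Letter I)) :
    localAct (σ * ρ) w z = localAct σ w (localAct ρ w z) := by
  induction w generalizing z with
  | nil => cases z <;> simp
  | cons a w ih =>
    rcases z with _ | ⟨b, z⟩
    · simp
    · by_cases h : a = b
      · subst h
        simp [ih]
      · simp [localAct_cons_of_ne _ h]

theorem head?_localAct_cons (σ : Gam S) (a : Letter I) (w z : List (Letter I)) :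
    (localAct σ (a :: w) z).head? = z.head? := by
  rcases z with _ | ⟨b, z⟩
  · simp
  · by_cases h : a = b
    · subst h
      simp
    · simp [localAct_cons_of_ne _ h]

theorem localAct_append_cons (σ : Gam S) (w : List (Letter I)) (a : Letter I)
    (z : List (Letter I)) : localAct σ w (w ++ a :: z) = w ++ letterPerm S σ a :: z := by
  induction w with
  | nil => rfl
  | cons b w ih => simp [ih]

theorem localAct_of_length_le (σ : Gam S) {w z : List (Letter I)} (h : z.length ≤ w.length) :
    localAct σ w z = z := by
  induction w generalizing z with
  | nil => simp_all
  | cons a w ih =>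
    rcases z with _ | ⟨b, z⟩
    · simp
    · by_cases hab : a = b
      · subst hab
        simp [ih (by simpa using h)]
      · rw [localAct_cons_of_ne _ hab]

theorem localAct_append_of_ne (σ : Gam S) {v w : List (Letter I)} (hlen : v.length = w.length)
    (hvw : v ≠ w) (z : List (Letter I)) : localAct σ v (w ++ z) = w ++ z := by
  induction v generalizing w with
  | nil => exact absurd (List.length_eq_zero_iff.1 hlen.symm).symm hvw
  | cons a v ih =>
    obtain ⟨b, w, rfl⟩ := List.exists_cons_of_length_pos (l := w) (by rw [← hlen]; simp)
    by_cases h : a = b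
    · subst h
      simp [ih (w := w) (by simpa using hlen) (by simpa using hvw)]
    · exact localAct_cons_of_ne _ h _ _

/-- Local permutations at distinct words of the same length commute, and so do local permutations
at extensions of these words. -/
theorem localAct_comm (σ ρ : Gam S) {v w : List (Letter I)} (hlen : v.length = w.length)
    (hvw : v ≠ w) (u z : List (Letter I)) :
    localAct σ v (localAct ρ (w ++ u) z) = localAct ρ (w ++ u) (localAct σ v z) := by
  induction v generalizing w z with
  | nil => exact absurd (List.length_eq_zero_iff.1 hlen.symm).symm hvw
  | cons a v ih =>
    obtain ⟨b, w, rfl⟩ := List.exists_cons_of_length_pos (l := w) (by rw [← hlen]; simp)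
    rcases z with _ | ⟨c, z⟩
    · simp
    · rw [List.cons_append]
      by_cases hb : b = c <;> by_cases ha : a = c
      · subst hb ha
        simp [ih (w := w) (by simpa using hlen) (by simpa using hvw)]
      · subst hb
        simp [localAct_cons_of_ne _ ha]
      · subst ha
        simp [localAct_cons_of_ne _ hb]
      · simp [localAct_cons_of_ne _ hb, localAct_cons_of_ne _ ha]

theorem localAct_localAct (σ ρ : Gam S) (w : List (Letter I)) (a : Letter I)
    (u z : List (Letter I)) :
    localAct σ w (localAct ρ (w ++ a :: u) z) =
      localAct ρ (w ++ letterPerm S σ a :: u) (localAct σ w z) := by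
  induction w generalizing z with
  | nil =>
    rcases z with _ | ⟨c, z⟩
    · simp
    · by_cases h : a = c
      · subst h
        simp
      · have h' : letterPerm S σ a ≠ letterPerm S σ c := fun hc => h (Equiv.injective _ hc)
        simp [localAct_cons_of_ne _ h, localAct_cons_of_ne _ h']
  | cons b w ih =>
    rcases z with _ | ⟨c, z⟩
    · simp
    · by_cases h : b = c
      · subst h
        simp [ih]
      · simp [localAct_cons_of_ne _ h]

/-- The condition `σ ∈ label w` ensures that no backtracking is created. -/
theorem admissible_localAct {σ : Gam S} {w z : List (Letter I)} (hσ : σ ∈ label ι S w)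
    (hz : Admissible ι z) : Admissible ι (localAct σ w z) := by
  induction w generalizing z with
  | nil =>
    rcases z with _ | ⟨b, z⟩
    · simpa using hz
    · rw [localAct_nil_cons]
      obtain ⟨h₁, h₂⟩ := admissible_cons.1 hz
      exact admissible_cons.2 ⟨h₁, h₂⟩
  | cons a w ih =>
    rcases z with _ | ⟨b, z⟩
    · simpa using hz
    · by_cases h : a = b
      · subst h
        rw [localAct_cons_self]
        obtain ⟨h₁, h₂⟩ := admissible_cons.1 hz
        refine admissible_cons.2 ⟨?_, ih (label_cons_le _ _ hσ) h₂⟩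
        rcases w with _ | ⟨c, w⟩
        · rcases z with _ | ⟨d, z⟩
          · simp
          · rw [mem_label_singleton] at hσ
            simp only [localAct_nil_cons, List.head?_cons, Option.mem_some_iff, forall_eq'] at h₁ ⊢
            intro hd
            rw [← hσ] at hd
            exact h₁ (Equiv.injective _ hd)
        · rwa [head?_localAct_cons]
      · rwa [localAct_cons_of_ne _ h]

/-! ### The translation along the axis -/

open Classical in
variable (ι) in
/-- Multiplication by the distinguished letter of sign `ε` from the left, followed by reduction. -/
noncomputable def consAxis (ε : ℤˣ) : List (Letter I) → List (Letter I)
  | [] => [axisLetter ι ε]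
  | b :: z => if b = axisLetter ι (-ε) then z else axisLetter ι ε :: b :: z

theorem consAxis_of_ne {ε : ℤˣ} {z : List (Letter I)}
    (h : ∀ b ∈ z.head?, b ≠ axisLetter ι (-ε)) : consAxis ι ε z = axisLetter ι ε :: z := by
  rcases z with _ | ⟨b, z⟩
  · rfl
  · exact if_neg (h b rfl)

theorem consAxis_cons_axisLetter (ε : ℤˣ) (z : List (Letter I)) :
    consAxis ι ε (axisLetter ι (-ε) :: z) = z := if_pos rfl

theorem admissible_consAxis {ε : ℤˣ} {z : List (Letter I)} (hz : Admissible ι z) :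
    Admissible ι (consAxis ι ε z) := by
  by_cases h : ∀ b ∈ z.head?, b ≠ axisLetter ι (-ε)
  · rw [consAxis_of_ne h]
    exact admissible_axisLetter_cons ι hz h
  · rcases z with _ | ⟨b, z⟩
    · simp at h
    · obtain rfl : b = axisLetter ι (-ε) := by simpa using h
      rw [consAxis_cons_axisLetter]
      exact (admissible_cons.1 hz).2

theorem consAxis_consAxis {ε δ : ℤˣ} (hδ : δ = -ε) {z : List (Letter I)} (hz : Admissible ι z) :
    consAxis ι δ (consAxis ι ε z) = z := by
  obtain rfl : ε = -δ := by rw [hδ, neg_neg]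
  by_cases h : ∀ b ∈ z.head?, b ≠ axisLetter ι (- -δ)
  · rw [consAxis_of_ne h, consAxis_cons_axisLetter]
  · rcases z with _ | ⟨b, z⟩
    · simp at h
    · obtain rfl : b = axisLetter ι (- -δ) := by simpa using h
      rw [consAxis_cons_axisLetter]
      have := (admissible_cons.1 hz).1
      rw [consAxis_of_ne (by simpa using this), neg_neg]

/-- Conjugation by the translation turns the local permutation at `w` into the one at
`(ι_{-ε}, ε) w`. -/
theorem consAxis_localAct {ε : ℤˣ} {σ : Gam S} {w z : List (Letter I)}
    (hw : Admissible ι (axisLetter ι ε :: w)) (hσ : σ ∈ label ι S (axisLetter ι ε :: w))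
    (hz : Admissible ι z) :
    consAxis ι ε (localAct σ w z) = localAct σ (axisLetter ι ε :: w) (consAxis ι ε z) := by
  rcases z with _ | ⟨c, z⟩
  · simp [consAxis]
  by_cases hc : c = axisLetter ι (-ε)
  · subst hc
    -- The translated word `z` does not begin with `axisLetter ι ε`.
    have hR : localAct σ (axisLetter ι ε :: w) z = z := by
      rcases z with _ | ⟨d, z⟩
      · simp
      · have := (admissible_cons.1 hz).1
        rw [localAct_cons_of_ne _ (by simpa using (this d rfl).symm)]
    rw [consAxis_cons_axisLetter, hR]
    rcases w with _ | ⟨b, w⟩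
    · have h₁ : letterPerm S σ (axisLetter ι (-ε)) = axisLetter ι (-ε) :=
        mem_label_singleton.1 hσ
      rw [localAct_nil_cons, h₁, consAxis_cons_axisLetter]
    · have : b ≠ axisLetter ι (-ε) := (admissible_cons.1 hw).1 b rfl
      rw [localAct_cons_of_ne _ this, consAxis_cons_axisLetter]
  · rw [consAxis_of_ne (z := c :: z) (by simpa using hc), localAct_cons_self, consAxis_of_ne]
    rcases w with _ | ⟨b, w⟩
    · have h₁ : letterPerm S σ (axisLetter ι (-ε)) = axisLetter ι (-ε) :=
        mem_label_singleton.1 hσ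
      simp only [localAct_nil_cons, List.head?_cons, Option.mem_some_iff, forall_eq']
      intro h
      rw [← h₁] at h
      exact hc (Equiv.injective _ h)
    · rw [head?_localAct_cons]
      simpa using hc

end Words

section Action

variable {I : ℤˣ → Type u} (ι : ∀ ε, I ε) (S : ∀ ε, Subgroup (Equiv.Perm (I ε)))

/-! ### The action of `Λ` on the tree -/

/-- The vertices of the tree on which `Λ` acts. The admissible words are the reduced paths that
start at the root, and a vertex is given by the path leading to it. -/
def Vertex : Type u := {w : List (Letter I) // Admissible ι w}

variable {ι S}

/-- The permutation of the vertices by which a symbol acts. -/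
noncomputable def symbPerm (x : Symb ι S) : Equiv.Perm (Vertex ι) where
  toFun v := ⟨localAct x.perm x.word v.1, admissible_localAct x.mem v.2⟩
  invFun v := ⟨localAct x.perm⁻¹ x.word v.1, admissible_localAct (inv_mem x.mem) v.2⟩
  left_inv v := Subtype.ext <| by
    change localAct x.perm⁻¹ x.word (localAct x.perm x.word v.1) = v.1
    rw [← localAct_mul, inv_mul_cancel, localAct_one]
  right_inv v := Subtype.ext <| by
    change localAct x.perm x.word (localAct x.perm⁻¹ x.word v.1) = v.1
    rw [← localAct_mul, mul_inv_cancel, localAct_one]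

theorem symbPerm_val (x : Symb ι S) (v : Vertex ι) :
    (symbPerm x v).1 = localAct x.perm x.word v.1 := rfl

variable (ι) in
/-- The permutation of the vertices by which `τ ^ ε` acts. -/
noncomputable def axisPerm (ε : ℤˣ) : Equiv.Perm (Vertex ι) where
  toFun v := ⟨consAxis ι ε v.1, admissible_consAxis v.2⟩
  invFun v := ⟨consAxis ι (-ε) v.1, admissible_consAxis v.2⟩
  left_inv v := Subtype.ext (consAxis_consAxis rfl v.2)
  right_inv v := Subtype.ext (consAxis_consAxis (neg_neg ε).symm v.2)

theorem axisPerm_val (ε : ℤˣ) (v : Vertex ι) : (axisPerm ι ε v).1 = consAxis ι ε v.1 := rfl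

theorem axisPerm_neg (ε : ℤˣ) : axisPerm ι (-ε) = (axisPerm ι ε)⁻¹ := Equiv.ext fun _ => rfl

theorem axisPerm_one_zpow (ε : ℤˣ) : axisPerm ι 1 ^ (ε : ℤ) = axisPerm ι ε := by
  rcases Int.units_eq_one_or ε with rfl | rfl
  · simp
  · simp [axisPerm_neg]

theorem axisPerm_symbPerm {ε : ℤˣ} {w : List (Letter I)} {σ : Gam S} (hw hσ)
    (hw' : Admissible ι (axisLetter ι ε :: w)) (hσ' : σ ∈ label ι S (axisLetter ι ε :: w)) :
    axisPerm ι ε * symbPerm ⟨w, σ, hw, hσ⟩ * (axisPerm ι ε)⁻¹ =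
      symbPerm ⟨axisLetter ι ε :: w, σ, hw', hσ'⟩ := by
  rw [mul_inv_eq_iff_eq_mul]
  exact Equiv.ext fun v => Subtype.ext (consAxis_localAct hw' hσ' v.2)

theorem symbPerm_conj {w u : List (Letter I)} {a : Letter I} {σ ρ : Gam S} (hw hσ h₁ hρ h₂ hρ₂) :
    symbPerm ⟨w, σ, hw, hσ⟩ * symbPerm ⟨w ++ a :: u, ρ, h₁, hρ⟩ * (symbPerm ⟨w, σ, hw, hσ⟩)⁻¹ =
      (symbPerm ⟨w ++ letterPerm S σ a :: u, ρ, h₂, hρ₂⟩ : Equiv.Perm (Vertex ι)) := by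
  rw [mul_inv_eq_iff_eq_mul]
  exact Equiv.ext fun v => Subtype.ext (localAct_localAct _ _ _ _ _ _)

theorem symbPerm_mul {w : List (Letter I)} {σ ρ : Gam S} (hw hσ hρ hσρ) :
    symbPerm ⟨w, σ, hw, hσ⟩ * symbPerm ⟨w, ρ, hw, hρ⟩ =
      (symbPerm ⟨w, σ * ρ, hw, hσρ⟩ : Equiv.Perm (Vertex ι)) :=
  Equiv.ext fun _ => Subtype.ext (localAct_mul _ _ _ _).symm

/-- The images in `Perm (Vertex ι)` of the generators of `Λ`. -/
noncomputable def genPerm : Gen ι S → Equiv.Perm (Vertex ι)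
  | .tau => axisPerm ι 1
  | .symb x => symbPerm x

theorem mulSingle_comm (s : S (-1)) (t : S 1) :
    (Pi.mulSingle (-1) s * Pi.mulSingle 1 t : Gam S) = Pi.mulSingle 1 t * Pi.mulSingle (-1) s :=
  Pi.mulSingle_commute (f := fun ε => S ε) (show (-1 : ℤˣ) ≠ 1 by decide) s t

theorem genPerm_rel {a b : FreeGroup (Gen ι S)} (hab : Rel ι S a b) :
    FreeGroup.lift genPerm a = FreeGroup.lift genPerm b := by
  cases hab with
  | r1 s t =>
    simp only [map_mul, fh, fh₀, FreeGroup.lift_apply_of, genPerm]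
    refine (symbPerm_mul _ _ _ (mem_label_nil _)).trans
      (Eq.trans ?_ (symbPerm_mul _ _ _ (mem_label_nil _)).symm)
    simp only [mulSingle_comm]
  | r2 v w u σ σ' hv hσ' hwu hσ hne hlen hvw =>
    simp only [map_mul, fh, FreeGroup.lift_apply_of, genPerm]
    exact Equiv.ext fun z => Subtype.ext (localAct_comm _ _ hlen hvw _ _)
  | r3 w u ε i σ σ' hw hσ h₁ hσ' h₂ hσ'₂ hne =>
    simp only [map_mul, map_inv, fh, FreeGroup.lift_apply_of, genPerm]
    exact symbPerm_conj _ _ _ _ _ _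
  | r4 w σ σ' hw hσ hσ' hσσ' hne =>
    simp only [map_mul, fh, FreeGroup.lift_apply_of, genPerm]
    exact symbPerm_mul _ _ _ _
  | r5 σ σ' =>
    simp only [map_mul, fh, fh₀, FreeGroup.lift_apply_of, genPerm]
    exact symbPerm_mul _ _ _ _
  | r6 u ε i σ σ' h₁ hσ' h₂ hσ'₂ =>
    simp only [map_mul, map_inv, fh, fh₀, FreeGroup.lift_apply_of, genPerm]
    exact symbPerm_conj (w := []) _ _ _ _ _ _
  | r7 ε σ h₁ hσ =>
    simp only [map_mul, map_zpow, fτ, fh, fh₀, FreeGroup.lift_apply_of, genPerm, zpow_neg,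
      map_inv, axisPerm_one_zpow]
    exact axisPerm_symbPerm _ _ _ _
  | r8 ε i u σ h₁ hσ h₂ hσ₂ =>
    simp only [map_mul, map_zpow, fτ, fh, FreeGroup.lift_apply_of, genPerm, zpow_neg,
      map_inv, axisPerm_one_zpow]
    exact axisPerm_symbPerm _ _ _ _
  | r9_eq ε u σ h₁ hσ h₂ hσ₂ =>
    simp only [map_mul, map_zpow, fτ, fh, FreeGroup.lift_apply_of, genPerm, zpow_neg,
      map_inv, axisPerm_one_zpow]
    have := axisPerm_symbPerm h₂ hσ₂ h₁ hσ
    rw [mul_inv_eq_iff_eq_mul] at this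
    rw [mul_assoc, inv_mul_eq_iff_eq_mul]
    exact this.symm
  | r9_ne ε i u σ h₁ hσ h₂ hσ₂ hi =>
    simp only [map_mul, map_zpow, fτ, fh, FreeGroup.lift_apply_of, genPerm, zpow_neg,
      map_inv, axisPerm_one_zpow]
    have := axisPerm_symbPerm (ε := -ε) h₁ hσ h₂ hσ₂
    rw [axisPerm_neg, inv_inv] at this
    exact this

/-- The homomorphism by which `Λ` acts on the vertices of the tree. -/
noncomputable def toVertexPerm : Lam ι S →* Equiv.Perm (Vertex ι) :=
  PresentedGroup.toGroup (f := genPerm) (by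
    rintro _ ⟨a, b, hab, rfl⟩
    rw [map_mul, map_inv, genPerm_rel hab, mul_inv_cancel])

noncomputable instance : MulAction (Lam ι S) (Vertex ι) :=
  MulAction.compHom (Vertex ι) (toVertexPerm (ι := ι) (S := S))

theorem h_smul (x : Symb ι S) (v : Vertex ι) : h ι S x • v = symbPerm x v :=
  congrArg (fun f : Equiv.Perm (Vertex ι) => f v)
    (PresentedGroup.toGroup.of _ : toVertexPerm (h ι S x) = symbPerm x)

theorem h_smul_val (x : Symb ι S) (v : Vertex ι) :
    (h ι S x • v).1 = localAct x.perm x.word v.1 := by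
  rw [h_smul, symbPerm_val]

theorem τ_zpow_smul (ε : ℤˣ) (v : Vertex ι) : τ ι S ^ (ε : ℤ) • v = axisPerm ι ε v := by
  have h₁ : toVertexPerm (τ ι S) = axisPerm ι 1 := PresentedGroup.toGroup.of _
  change toVertexPerm (τ ι S ^ (ε : ℤ)) v = _
  rw [map_zpow, h₁, axisPerm_one_zpow]

theorem τ_zpow_smul_val (ε : ℤˣ) (v : Vertex ι) :
    (τ ι S ^ (ε : ℤ) • v).1 = consAxis ι ε v.1 := by
  rw [τ_zpow_smul, axisPerm_val]

theorem h₀_smul_val (σ : Gam S) (v : Vertex ι) : (h₀ ι S σ • v).1 = localAct σ [] v.1 :=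
  h_smul_val _ _

end Action

section Relations

variable {I : ℤˣ → Type u} {ι : ∀ ε, I ε} {S : ∀ ε, Subgroup (Equiv.Perm (I ε))}

/-! ### The relations in `Λ` -/

theorem h_mul_h {w : List (Letter I)} {σ ρ : Gam S} (hw hσ hρ hσρ) :
    h ι S ⟨w, σ, hw, hσ⟩ * h ι S ⟨w, ρ, hw, hρ⟩ = h ι S ⟨w, σ * ρ, hw, hσρ⟩ := by
  rcases w with _ | ⟨a, w⟩
  · exact of_rel (Rel.r5 σ ρ)
  · exact of_rel (Rel.r4 _ σ ρ hw hσ hρ hσρ (List.cons_ne_nil _ _))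

theorem h_one {w : List (Letter I)} (hw h₁) : h ι S ⟨w, 1, hw, h₁⟩ = 1 := by
  have := h_mul_h hw h₁ h₁ (by simp)
  simpa using this

theorem h_inv {w : List (Letter I)} {σ : Gam S} (hw hσ) :
    (h ι S ⟨w, σ, hw, hσ⟩)⁻¹ = h ι S ⟨w, σ⁻¹, hw, inv_mem hσ⟩ := by
  rw [inv_eq_iff_mul_eq_one, h_mul_h _ _ _ (by simp)]
  simp only [mul_inv_cancel]
  exact h_one _ _

theorem h_comm {v w u : List (Letter I)} {σ ρ : Gam S} (hv hσ hw hρ)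
    (hlen : v.length = w.length) (hvw : v ≠ w) :
    h ι S ⟨v, σ, hv, hσ⟩ * h ι S ⟨w ++ u, ρ, hw, hρ⟩ =
      h ι S ⟨w ++ u, ρ, hw, hρ⟩ * h ι S ⟨v, σ, hv, hσ⟩ := by
  refine of_rel (Rel.r2 v w u ρ σ hv hσ hw hρ ?_ hlen hvw)
  rintro rfl
  exact hvw (List.length_eq_zero_iff.1 hlen.symm).symm

theorem h_conj_h {w u : List (Letter I)} {a : Letter I} {σ ρ : Gam S} (hw hσ h₁ hρ h₂ hρ₂) :
    h ι S ⟨w, σ, hw, hσ⟩ * h ι S ⟨w ++ a :: u, ρ, h₁, hρ⟩ * (h ι S ⟨w, σ, hw, hσ⟩)⁻¹ =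
      h ι S ⟨w ++ letterPerm S σ a :: u, ρ, h₂, hρ₂⟩ := by
  rcases w with _ | ⟨b, w⟩
  · exact of_rel (Rel.r6 u a.1 a.2 σ ρ h₁ hρ h₂ hρ₂)
  · exact of_rel (Rel.r3 _ u a.1 a.2 σ ρ hw hσ h₁ hρ h₂ hρ₂ (List.cons_ne_nil _ _))

theorem τ_conj_h {ε : ℤˣ} {w : List (Letter I)} {σ : Gam S} (hw hσ h₁ hσ₁) :
    τ ι S ^ (ε : ℤ) * h ι S ⟨w, σ, hw, hσ⟩ * (τ ι S ^ (ε : ℤ))⁻¹ =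
      h ι S ⟨axisLetter ι ε :: w, σ, h₁, hσ₁⟩ := by
  have key : τ ι S ^ (-ε : ℤ) * h ι S ⟨axisLetter ι ε :: w, σ, h₁, hσ₁⟩ * τ ι S ^ (ε : ℤ) =
      h ι S ⟨w, σ, hw, hσ⟩ := of_rel (Rel.r9_eq ε w σ h₁ hσ₁ hw hσ)
  rw [← key, zpow_neg]
  group

variable (ι S) in
/-- The homomorphism `σ ↦ h(σ)`. -/
def h₀Hom : Gam S →* Lam ι S where
  toFun := h₀ ι S
  map_one' := h_one _ _
  map_mul' _ _ := (h_mul_h _ _ _ _).symm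

@[simp]
theorem h₀Hom_apply (σ : Gam S) : h₀Hom ι S σ = h₀ ι S σ := rfl

theorem h₀_mul (σ ρ : Gam S) : h₀ ι S (σ * ρ) = h₀ ι S σ * h₀ ι S ρ := (h₀Hom ι S).map_mul σ ρ

theorem h₀_inv (σ : Gam S) : h₀ ι S σ⁻¹ = (h₀ ι S σ)⁻¹ := (h₀Hom ι S).map_inv σ

theorem h₀_one : h₀ ι S 1 = 1 := (h₀Hom ι S).map_one

theorem h₀_conj_h {a : Letter I} {u : List (Letter I)} {σ ρ : Gam S} (h₁ hρ h₂ hρ₂) :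
    h₀ ι S σ * h ι S ⟨a :: u, ρ, h₁, hρ⟩ * (h₀ ι S σ)⁻¹ =
      h ι S ⟨letterPerm S σ a :: u, ρ, h₂, hρ₂⟩ :=
  h_conj_h (w := []) _ _ _ _ _ _

/-! ### Transport along paths -/

theorem letterPerm_mulSingle {δ : ℤˣ} (s : S (-δ)) {a : Letter I} (ha : a.1 ≠ δ) :
    letterPerm S (Pi.mulSingle (-δ) s) a = a := by
  obtain ⟨ε, i⟩ := a
  have : (Pi.mulSingle (-δ) s : Gam S) (-ε) = 1 :=
    Pi.mulSingle_eq_of_ne (M := fun ε => S ε) (i := -δ) (i' := -ε) (fun h => ha (neg_injective h)) s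
  rw [letterPerm_mk, this]
  rfl

theorem gam_induction {p : Gam S → Prop}
    (single : ∀ (δ : ℤˣ) (s : S (-δ)), p (Pi.mulSingle (-δ) s))
    (mul : ∀ σ ρ, p σ → p ρ → p (σ * ρ)) (σ : Gam S) : p σ := by
  have single' : ∀ (ε : ℤˣ) (s : S ε), p (Pi.mulSingle ε s) := by
    intro ε
    obtain ⟨δ, rfl⟩ : ∃ δ : ℤˣ, ε = -δ := ⟨-ε, (neg_neg ε).symm⟩
    exact single δ
  have : σ = Pi.mulSingle (-1) (σ (-1)) * Pi.mulSingle 1 (σ 1) := by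
    funext ε
    rcases Int.units_eq_one_or ε with rfl | rfl <;> simp [Pi.mulSingle, Function.update]
  rw [this]
  exact mul _ _ (single' _ _) (single' _ _)

/-- Two letters of the same sign are conjugate under `Γ`, by an element fixing the letters of
the other sign. -/
theorem exists_letterPerm_eq [∀ ε, MulAction.IsPretransitive (S ε) (I ε)] (a b : Letter I)
    (hab : a.1 = b.1) :
    ∃ s : S (-a.1), letterPerm S (Pi.mulSingle (-a.1) s) a = b := by
  obtain ⟨ε, i⟩ := a
  obtain ⟨δ, j⟩ := b
  obtain rfl : ε = δ := hab
  obtain ⟨s, hs⟩ := MulAction.exists_smul_eq (S (-ε)) i j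
  refine ⟨s, ?_⟩
  rw [letterPerm_mk, Pi.mulSingle_eq_same]
  exact congrArg _ hs

variable [∀ ε, MulAction.IsPretransitive (S ε) (I ε)]

variable (S) in
open Classical in
/-- An element of `Γ` which maps the distinguished letter of the sign of `a` to `a`. It is chosen
to be trivial if `a` is distinguished. -/
noncomputable def letterRep (a : Letter I) : Gam S :=
  if a = axisLetter ι a.1 then 1
  else Pi.mulSingle (-a.1) (exists_letterPerm_eq (S := S) (axisLetter ι a.1) a rfl).choose

theorem letterPerm_letterRep (a : Letter I) :
    letterPerm S (letterRep (ι := ι) S a) (axisLetter ι a.1) = a := by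
  rw [letterRep]
  split_ifs with h
  · rw [map_one, Equiv.Perm.one_apply]
    exact h.symm
  · exact (exists_letterPerm_eq (S := S) (axisLetter ι a.1) a rfl).choose_spec

theorem letterRep_axisLetter (ε : ℤˣ) : letterRep (ι := ι) S (axisLetter ι ε) = 1 := if_pos rfl

variable (ι S) in
/-- An element of `Λ` which moves the root of the tree to its neighbour `a`. -/
noncomputable def letterElt (a : Letter I) : Lam ι S :=
  h₀ ι S (letterRep (ι := ι) S a) * τ ι S ^ (a.1 : ℤ)

theorem letterElt_axisLetter (ε : ℤˣ) : letterElt ι S (axisLetter ι ε) = τ ι S ^ (ε : ℤ) := by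
  rw [letterElt, letterRep_axisLetter, h₀_one, one_mul, axisLetter_fst]

theorem letterElt_conj_h {a : Letter I} {w : List (Letter I)} {σ : Gam S} (hw hσ h₁ hσ₁) :
    letterElt ι S a * h ι S ⟨w, σ, hw, hσ⟩ * (letterElt ι S a)⁻¹ =
      h ι S ⟨a :: w, σ, h₁, hσ₁⟩ := by
  have h₂ : Admissible ι (axisLetter ι a.1 :: w) :=
    admissible_axisLetter_cons ι hw (admissible_cons.1 h₁).1
  have hσ₂ : σ ∈ label ι S (axisLetter ι a.1 :: w) := by
    rcases w with _ | ⟨b, w⟩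
    · exact hσ₁
    · rwa [label_cons_cons] at hσ₁ ⊢
  have h₃ : Admissible ι (letterPerm S (letterRep (ι := ι) S a) (axisLetter ι a.1) :: w) := by
    rwa [letterPerm_letterRep]
  have hσ₃ : σ ∈ label ι S (letterPerm S (letterRep (ι := ι) S a) (axisLetter ι a.1) :: w) := by
    rwa [letterPerm_letterRep]
  have key := h₀_conj_h h₂ hσ₂ h₃ hσ₃
  rw [← τ_conj_h hw hσ h₂ hσ₂] at key
  simp only [letterPerm_letterRep] at key
  rw [← key, letterElt]
  group

variable (ι S) in
/-- An element of `Λ` which moves the root of the tree to the vertex `w`. -/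
noncomputable def pathElt (w : List (Letter I)) : Lam ι S := (w.map (letterElt ι S)).prod

@[simp]
theorem pathElt_nil : pathElt ι S [] = 1 := rfl

@[simp]
theorem pathElt_cons (a : Letter I) (w : List (Letter I)) :
    pathElt ι S (a :: w) = letterElt ι S a * pathElt ι S w := rfl

/-- Every symbol `h(w; σ)` is a conjugate of `h(σ)`. -/
theorem pathElt_conj_h₀ {w : List (Letter I)} {σ : Gam S} (hw hσ) :
    pathElt ι S w * h₀ ι S σ * (pathElt ι S w)⁻¹ = h ι S ⟨w, σ, hw, hσ⟩ := by
  induction w with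
  | nil => simp [h₀]
  | cons a w ih =>
    rw [← letterElt_conj_h (admissible_cons.1 hw).2 (label_cons_le _ _ hσ) hw hσ,
      ← ih (admissible_cons.1 hw).2 (label_cons_le _ _ hσ), pathElt_cons]
    group

theorem letterElt_mem_closure (a : Letter I) :
    letterElt ι S a ∈ Subgroup.closure (insert (τ ι S) (Set.range (h₀ ι S))) := by
  rw [letterElt]
  exact mul_mem (Subgroup.subset_closure (Set.mem_insert_of_mem _ ⟨_, rfl⟩))
    (zpow_mem (Subgroup.subset_closure (Set.mem_insert _ _)) _)

/-- The group `Λ` is generated by `τ` and the `h(σ)`, `σ ∈ Γ`. -/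
theorem closure_τ_h₀ : Subgroup.closure (insert (τ ι S) (Set.range (h₀ ι S))) = ⊤ := by
  rw [eq_top_iff, ← PresentedGroup.closure_range_of, Subgroup.closure_le]
  rintro _ ⟨x, rfl⟩
  cases x with
  | tau => exact Subgroup.subset_closure (Or.inl rfl)
  | symb x =>
    obtain ⟨w, σ, hw, hσ⟩ := x
    have key : pathElt ι S w * h₀ ι S σ * (pathElt ι S w)⁻¹ =
      PresentedGroup.of (Gen.symb ⟨w, σ, hw, hσ⟩) := pathElt_conj_h₀ hw hσ
    have hp : pathElt ι S w ∈ Subgroup.closure (insert (τ ι S) (Set.range (h₀ ι S))) := by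
      refine Subgroup.list_prod_mem _ fun x hx => ?_
      obtain ⟨a, -, rfl⟩ := List.mem_map.1 hx
      exact letterElt_mem_closure a
    rw [SetLike.mem_coe, ← key]
    exact mul_mem (mul_mem hp (Subgroup.subset_closure (Or.inr ⟨σ, rfl⟩))) (inv_mem hp)

/-! ### The stabilizer of the root -/

/-- A symbol `h(x)` carries the coset `pathElt u · G` to the coset which belongs to the word
`h(x) • u`. -/
theorem pathElt_inv_mul_h_mul_mem_base (x : Symb ι S) {u : List (Letter I)}
    (hu : Admissible ι u) :
    (pathElt ι S (localAct x.perm x.word u))⁻¹ * h ι S x * pathElt ι S u ∈ base ι S := by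
  induction u generalizing x with
  | nil => simpa using h_mem_base x
  | cons a u ih =>
    obtain ⟨hau, hu'⟩ := admissible_cons.1 hu
    -- The symbols whose word begins with the letter leading back to the root fix `u`.
    have fixed : ∀ y : Symb ι S, y.word.head? = some (axisLetter ι (-a.1)) →
        (pathElt ι S u)⁻¹ * h ι S y * pathElt ι S u ∈ base ι S := by
      rintro ⟨w, σ, hw, hσ⟩ hy
      have := ih ⟨w, σ, hw, hσ⟩ hu'
      rcases w with _ | ⟨b, w⟩
      · simp at hy
      · obtain rfl : b = axisLetter ι (-a.1) := by simpa using hy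
        have hfix : localAct σ (axisLetter ι (-a.1) :: w) u = u := by
          rcases u with _ | ⟨c, u⟩
          · simp
          · exact localAct_cons_of_ne _ (hau c rfl).symm _ _
        dsimp only at this
        rwa [hfix] at this
    obtain ⟨w, σ, hw, hσ⟩ := x
    rcases w with _ | ⟨c, w⟩
    · -- The letters `a` and `σ a` have the same sign.
      set b := letterPerm S σ a with hb
      set ρ := (letterRep (ι := ι) S b)⁻¹ * σ * letterRep (ι := ι) S a with hρdef
      have hρ : letterPerm S ρ (axisLetter ι a.1) = axisLetter ι a.1 := by
        rw [hρdef, map_mul, map_mul, Equiv.Perm.mul_apply, letterPerm_letterRep,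
          Equiv.Perm.mul_apply, ← hb, map_inv, Equiv.Perm.inv_eq_iff_eq]
        exact (letterPerm_letterRep b).symm
      have hρ' : ρ ∈ label ι S [axisLetter ι (-a.1)] := by
        rw [mem_label_singleton, axisLetter_fst, neg_neg]
        exact hρ
      have key := τ_conj_h (ε := -a.1) (admissible_nil ι) (mem_label_nil ρ)
        (admissible_singleton _) hρ'
      have := fixed ⟨_, _, admissible_singleton _, hρ'⟩ rfl
      rw [← key] at this
      have hh : h ι S ⟨[], ρ, admissible_nil ι, mem_label_nil ρ⟩ =
          (h₀ ι S (letterRep (ι := ι) S b))⁻¹ * h₀ ι S σ * h₀ ι S (letterRep (ι := ι) S a) := by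
        rw [← h₀_inv, ← h₀_mul, ← h₀_mul]
        rfl
      rw [hh, Units.val_neg, zpow_neg, inv_inv] at this
      change (pathElt ι S (b :: u))⁻¹ * h₀ ι S σ * pathElt ι S (a :: u) ∈ base ι S
      rw [pathElt_cons, pathElt_cons, letterElt, letterElt,
        show b.1 = a.1 from rfl]
      convert this using 1
      group
    · by_cases hca : c = a
      · subst hca
        have := ih ⟨w, σ, (admissible_cons.1 hw).2, label_cons_le _ _ hσ⟩ hu'
        dsimp only at this ⊢
        rw [localAct_cons_self, pathElt_cons, pathElt_cons,
          ← letterElt_conj_h (admissible_cons.1 hw).2 (label_cons_le _ _ hσ) hw hσ]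
        convert this using 1
        group
      · set ρ := (letterRep (ι := ι) S a)⁻¹ with hρ
        have hne : letterPerm S ρ c ≠ axisLetter ι a.1 := by
          rw [hρ, map_inv, Ne, Equiv.Perm.inv_eq_iff_eq]
          intro hc
          exact hca (hc.trans (letterPerm_letterRep a))
        have h₁ : Admissible ι (letterPerm S ρ c :: w) := by
          rw [admissible_cons, letterPerm_fst]
          exact admissible_cons.1 hw
        have hσ₁ : σ ∈ label ι S (letterPerm S ρ c :: w) := by
          rw [← List.nil_append (_ :: w), label_append_letterPerm]
          exact hσ
        have h₂ : Admissible ι (axisLetter ι (-a.1) :: letterPerm S ρ c :: w) :=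
          admissible_axisLetter_cons ι h₁ (by simpa using hne)
        have hσ₂ : σ ∈ label ι S (axisLetter ι (-a.1) :: letterPerm S ρ c :: w) := by
          rwa [label_cons_cons]
        have := fixed ⟨_, σ, h₂, hσ₂⟩ rfl
        rw [← τ_conj_h h₁ hσ₁ h₂ hσ₂, ← h₀_conj_h hw hσ h₁ hσ₁, hρ, h₀_inv, Units.val_neg,
          zpow_neg, inv_inv] at this
        dsimp only at this ⊢
        rw [localAct_cons_of_ne _ hca, pathElt_cons, letterElt]
        convert this using 1
        group

theorem τ_zpow_mul_pathElt (ε : ℤˣ) (u : List (Letter I)) :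
    τ ι S ^ (ε : ℤ) * pathElt ι S u = pathElt ι S (consAxis ι ε u) := by
  by_cases h : ∀ b ∈ u.head?, b ≠ axisLetter ι (-ε)
  · rw [consAxis_of_ne h, pathElt_cons, letterElt_axisLetter]
  · rcases u with _ | ⟨b, u⟩
    · simp at h
    · obtain rfl : b = axisLetter ι (-ε) := by simpa using h
      rw [consAxis_cons_axisLetter, pathElt_cons, letterElt_axisLetter, Units.val_neg, zpow_neg,
        mul_inv_cancel_left]

/-- The map `w ↦ pathElt w · G` from the vertices to the cosets of `G` is equivariant. -/
theorem pathElt_inv_mul_mul_mem_base (g : Lam ι S) (v : Vertex ι) :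
    (pathElt ι S (g • v).1)⁻¹ * g * pathElt ι S v.1 ∈ base ι S := by
  have hg : g ∈ Subgroup.closure (Set.range (PresentedGroup.of (rels := rels ι S))) := by
    rw [PresentedGroup.closure_range_of]
    exact Subgroup.mem_top g
  induction hg using Subgroup.closure_induction generalizing v with
  | mem x hx =>
    obtain ⟨y, rfl⟩ := hx
    cases y with
    | tau =>
      change (pathElt ι S (τ ι S • v).1)⁻¹ * τ ι S * pathElt ι S v.1 ∈ base ι S
      have h₁ := τ_zpow_smul_val (S := S) 1 v
      have h₂ := τ_zpow_mul_pathElt (ι := ι) (S := S) 1 v.1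
      rw [Units.val_one, zpow_one] at h₁ h₂
      rw [h₁, mul_assoc, h₂, inv_mul_cancel]
      exact one_mem _
    | symb x =>
      change (pathElt ι S (h ι S x • v).1)⁻¹ * h ι S x * pathElt ι S v.1 ∈ base ι S
      rw [h_smul_val]
      exact pathElt_inv_mul_h_mul_mem_base x v.2
  | one => simp
  | mul x y _ _ hx hy =>
    have := mul_mem (hx (y • v)) (hy v)
    rw [mul_smul]
    convert this using 1
    group
  | inv x _ hx =>
    have := inv_mem (hx (x⁻¹ • v))
    rw [smul_inv_smul] at this
    convert this using 1
    group

variable (ι) in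
/-- The root of the tree. -/
def root : Vertex ι := ⟨[], admissible_nil ι⟩

theorem mem_base_of_smul_root {g : Lam ι S} (hg : g • root ι = root ι) : g ∈ base ι S := by
  have := pathElt_inv_mul_mul_mem_base g (root ι)
  rw [hg] at this
  simpa [root] using this

end Relations

section Faithful

variable {I : ℤˣ → Type u} {ι : ∀ ε, I ε} {S : ∀ ε, Subgroup (Equiv.Perm (I ε))}

/-! ### Faithfulness -/

variable (ι S) in
/-- The subgroup of `G` generated by the symbols `h(w; σ)` with `w ∈ A`. -/
def wordSubgroup (A : Set (List (Letter I))) : Subgroup (Lam ι S) :=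
  Subgroup.closure (h ι S '' {x | x.word ∈ A})

theorem h_mem_wordSubgroup {A : Set (List (Letter I))} {x : Symb ι S} (hx : x.word ∈ A) :
    h ι S x ∈ wordSubgroup ι S A :=
  Subgroup.subset_closure ⟨x, hx, rfl⟩

theorem wordSubgroup_mono {A B : Set (List (Letter I))} (hAB : A ⊆ B) :
    wordSubgroup ι S A ≤ wordSubgroup ι S B :=
  Subgroup.closure_mono (Set.image_mono fun _ hx => hAB hx)

/-- An element of `wordSubgroup A` fixes every vertex fixed by all the `h(w; σ)` with `w ∈ A`. -/
theorem smul_eq_of_mem_wordSubgroup {A : Set (List (Letter I))} {v : Vertex ι}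
    (hv : ∀ w ∈ A, ∀ σ : Gam S, localAct σ w v.1 = v.1) {g : Lam ι S}
    (hg : g ∈ wordSubgroup ι S A) : g • v = v := by
  have : wordSubgroup ι S A ≤ MulAction.stabilizer (Lam ι S) v := by
    refine (Subgroup.closure_le _).2 ?_
    rintro _ ⟨x, hx, rfl⟩
    exact Subtype.ext ((h_smul_val x v).trans (hv _ hx _))
  exact this hg

/-- If `wordSubgroup A` normalizes `wordSubgroup B`, then their product is
`wordSubgroup (A ∪ B)`. -/
theorem exists_mul_of_mem_wordSubgroup_union {A B : Set (List (Letter I))}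
    (hAB : ∀ x y : Symb ι S, x.word ∈ A → y.word ∈ B →
      h ι S x * h ι S y * (h ι S x)⁻¹ ∈ wordSubgroup ι S B)
    {g : Lam ι S} (hg : g ∈ wordSubgroup ι S (A ∪ B)) :
    ∃ l ∈ wordSubgroup ι S A, ∃ r ∈ wordSubgroup ι S B, g = l * r := by
  have conj : ∀ x : Symb ι S, x.word ∈ A → ∀ r ∈ wordSubgroup ι S B,
      h ι S x * r * (h ι S x)⁻¹ ∈ wordSubgroup ι S B := by
    intro x hx
    have : wordSubgroup ι S B ≤
        (wordSubgroup ι S B).comap (MulAut.conj (h ι S x)).toMonoidHom := by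
      refine (Subgroup.closure_le _).2 ?_
      rintro _ ⟨y, hy, rfl⟩
      exact hAB x y hx hy
    exact fun r hr => this hr
  have hle : wordSubgroup ι S A ≤ Subgroup.normalizer (wordSubgroup ι S B : Set (Lam ι S)) := by
    refine (Subgroup.closure_le _).2 ?_
    rintro _ ⟨x, hx, rfl⟩
    refine Subgroup.mem_normalizer_iff.2 fun r => ⟨conj x hx r, fun hr => ?_⟩
    have := conj ⟨x.word, x.perm⁻¹, x.reduced, inv_mem x.mem⟩ hx _ hr
    rw [← h_inv x.reduced x.mem] at this
    convert this using 1
    group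
  have hsup : wordSubgroup ι S (A ∪ B) = wordSubgroup ι S A ⊔ wordSubgroup ι S B := by
    rw [wordSubgroup, wordSubgroup, wordSubgroup, ← Subgroup.closure_union, ← Set.image_union]
    rfl
  rw [hsup, ← SetLike.mem_coe, Subgroup.coe_mul_of_left_le_normalizer_right _ _ hle] at hg
  obtain ⟨l, hl, r, hr, rfl⟩ := hg
  exact ⟨l, hl, r, hr, rfl⟩

theorem eq_one_or_eq_h_of_mem_wordSubgroup_singleton {w : List (Letter I)} {g : Lam ι S}
    (hg : g ∈ wordSubgroup ι S {w}) : g = 1 ∨ ∃ x : Symb ι S, x.word = w ∧ g = h ι S x := by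
  induction hg using Subgroup.closure_induction with
  | mem g hg =>
    obtain ⟨x, hx, rfl⟩ := hg
    exact Or.inr ⟨x, hx, rfl⟩
  | one => exact Or.inl rfl
  | mul a b _ _ ha hb =>
    rcases ha with rfl | ⟨⟨_, σ, hw, hσ⟩, rfl, rfl⟩
    · rwa [one_mul]
    · rcases hb with rfl | ⟨⟨_, ρ, hw, hρ⟩, rfl, rfl⟩
      · exact Or.inr ⟨⟨_, σ, hw, hσ⟩, rfl, mul_one _⟩
      · exact Or.inr ⟨⟨_, σ * ρ, hw, mul_mem hσ hρ⟩, rfl, h_mul_h _ _ _ _⟩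
  | inv a _ ha =>
    rcases ha with rfl | ⟨⟨_, σ, hw, hσ⟩, rfl, rfl⟩
    · exact Or.inl inv_one
    · exact Or.inr ⟨⟨_, σ⁻¹, hw, inv_mem hσ⟩, rfl, h_inv _ _⟩

theorem mem_label_iff {w : List (Letter I)} {σ : Gam S} :
    σ ∈ label ι S w ↔
      ∀ c ∈ w.getLast?, letterPerm S σ (axisLetter ι (-c.1)) = axisLetter ι (-c.1) := by
  simp only [letterPerm_axisLetter_neg_iff, label]
  rcases w.getLast? with _ | c <;> simp

/-- A symbol `h(w; σ)` is trivial if it fixes the neighbours of the vertex `w`. -/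
theorem perm_eq_one_of_smul (x : Symb ι S)
    (hx : ∀ v : Vertex ι, v.1.length = x.word.length + 1 → h ι S x • v = v) : x.perm = 1 := by
  refine letterPerm_injective (Equiv.ext fun a => ?_)
  rw [map_one, Equiv.Perm.one_apply]
  by_cases ha : ∀ c ∈ x.word.getLast?, a ≠ axisLetter ι (-c.1)
  · have hw : Admissible ι (x.word ++ [a]) := by
      rw [admissible_iff, List.isChain_append]
      refine ⟨(admissible_iff ι).1 x.reduced, List.isChain_singleton _, fun c hc b hb => ?_⟩
      obtain rfl : a = b := by simpa using hb
      exact ha c hc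
    have := (h_smul_val x ⟨_, hw⟩).symm.trans (congrArg Subtype.val (hx ⟨_, hw⟩ (by simp)))
    rw [localAct_append_cons] at this
    simpa using this
  · push Not at ha
    obtain ⟨c, hc, rfl⟩ := ha
    exact mem_label_iff.1 x.mem c hc

/-- The symbols for finitely many words of length `k` generate a direct product, in which each
factor is determined by its action on the neighbours of its own vertex. -/
theorem eq_one_of_mem_wordSubgroup_finset {k : ℕ} (A : Finset (List (Letter I)))
    (hA : ∀ w ∈ A, w.length = k) {g : Lam ι S} (hg : g ∈ wordSubgroup ι S (A : Set _))
    (hfix : ∀ v : Vertex ι, v.1.length = k + 1 → g • v = v) : g = 1 := by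
  classical
  induction A using Finset.induction_on generalizing g with
  | empty => simpa [wordSubgroup] using hg
  | insert w A hw ih =>
    have hlen : ∀ u ∈ A, u.length = w.length := fun u hu =>
      (hA u (Finset.mem_insert_of_mem hu)).trans (hA w (Finset.mem_insert_self _ _)).symm
    have hne : ∀ u ∈ A, u ≠ w := fun u hu h => hw (h ▸ hu)
    rw [Finset.coe_insert, Set.insert_eq] at hg
    obtain ⟨l, hl, r, hr, rfl⟩ := exists_mul_of_mem_wordSubgroup_union (by
      rintro ⟨u, σ, hu, hσ⟩ ⟨u', ρ, hu', hρ⟩ (rfl : u = w) (hA' : u' ∈ A)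
      have := h_comm (u := []) hu hσ (w := u') (by simpa using hu') (by simpa using hρ)
        (hlen _ hA').symm (hne _ hA').symm
      simp only [List.append_nil] at this
      rw [this, mul_inv_cancel_right]
      exact h_mem_wordSubgroup hA') hg
    have hl1 : l = 1 := by
      rcases eq_one_or_eq_h_of_mem_wordSubgroup_singleton hl with h | ⟨x, rfl, rfl⟩
      · exact h
      · -- Below `x.word` the factor `r` acts trivially; elsewhere `h(x)` does.
        have : x.perm = 1 := by
          refine perm_eq_one_of_smul x fun v hv => ?_
          by_cases hpre : x.word <+: v.1
          · have hrv : r • v = v := by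
              refine smul_eq_of_mem_wordSubgroup (fun u hu σ => ?_) hr
              obtain ⟨z, hz⟩ := hpre
              rw [← hz]
              exact localAct_append_of_ne _ (hlen u hu) (hne u hu) _
            have := hfix v (by rw [hv, hA _ (Finset.mem_insert_self _ _)])
            rwa [mul_smul, hrv] at this
          · refine Subtype.ext ?_
            rw [h_smul_val, ← List.take_append_drop x.word.length v.1]
            refine localAct_append_of_ne _ (by simp [hv]) (fun h => hpre ?_) _
            rw [List.prefix_iff_eq_take]
            exact h
        obtain ⟨w, σ, h₁, h₂⟩ := x
        obtain rfl : σ = 1 := this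
        exact h_one _ _
    rw [hl1, one_mul] at hfix ⊢
    exact ih (fun u hu => hA u (Finset.mem_insert_of_mem hu)) hr hfix

theorem eq_one_of_mem_wordSubgroup_length {k : ℕ} {g : Lam ι S}
    (hg : g ∈ wordSubgroup ι S {w | w.length = k})
    (hfix : ∀ v : Vertex ι, v.1.length = k + 1 → g • v = v) : g = 1 := by
  classical
  obtain ⟨A, hA, hgA⟩ : ∃ A : Finset (List (Letter I)), (∀ w ∈ A, w.length = k) ∧
      g ∈ wordSubgroup ι S (A : Set _) := by
    clear hfix
    induction hg using Subgroup.closure_induction with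
    | mem g hg =>
      obtain ⟨x, hx, rfl⟩ := hg
      exact ⟨{x.word}, by simpa using hx, h_mem_wordSubgroup (by simp)⟩
    | one => exact ⟨∅, by simp, one_mem _⟩
    | mul a b _ _ ha hb =>
      obtain ⟨A, hA, ha⟩ := ha
      obtain ⟨B, hB, hb⟩ := hb
      refine ⟨A ∪ B, fun w hw => (Finset.mem_union.1 hw).elim (hA w) (hB w), mul_mem ?_ ?_⟩
      · exact wordSubgroup_mono (by simp) ha
      · exact wordSubgroup_mono (by simp) hb
    | inv a _ ha =>
      obtain ⟨A, hA, ha⟩ := ha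
      exact ⟨A, hA, inv_mem ha⟩
  exact eq_one_of_mem_wordSubgroup_finset A hA hgA hfix

/-- The symbols of length `k` normalize the group generated by the longer ones, so an element is the
product of a part of level `k` and a part of higher levels. The second part fixes all words of
length `k + 1`, so the first one is trivial if the product acts trivially. -/
theorem eq_one_of_mem_wordSubgroup_of_smul {m k : ℕ} {g : Lam ι S}
    (hg : g ∈ wordSubgroup ι S {w | k ≤ w.length ∧ w.length < k + m})
    (hfix : ∀ v : Vertex ι, g • v = v) : g = 1 := by
  induction m generalizing k g with
  | zero =>
    have : {w : List (Letter I) | k ≤ w.length ∧ w.length < k + 0} = ∅ :=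
      Set.eq_empty_of_forall_notMem fun w hw => absurd hw.2 (not_lt.2 hw.1)
    rw [this] at hg
    simpa [wordSubgroup] using hg
  | succ m ih =>
    have hsplit : {w : List (Letter I) | k ≤ w.length ∧ w.length < k + (m + 1)} =
        {w | w.length = k} ∪ {w | k + 1 ≤ w.length ∧ w.length < k + 1 + m} := by
      ext w
      simp only [Set.mem_ofPred_eq, Set.mem_union]
      omega
    rw [hsplit] at hg
    obtain ⟨l, hl, r, hr, rfl⟩ := exists_mul_of_mem_wordSubgroup_union (by
      rintro ⟨v, σ, hv, hσ⟩ ⟨w, ρ, hw, hρ⟩ (hvk : v.length = k) ⟨hk, hm⟩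
      dsimp only at hk hm
      obtain ⟨z, hz⟩ : ∃ z, w = w.take k ++ z := ⟨_, (List.take_append_drop k w).symm⟩
      have hlen : (w.take k).length = k := by
        rw [List.length_take]
        omega
      rcases z with _ | ⟨a, z⟩
      · rw [List.append_nil] at hz
        rw [← hz] at hlen
        omega
      generalize w.take k = w' at hz hlen
      subst hz
      by_cases hvw : v = w'
      · subst hvw
        have hw₂ : Admissible ι (v ++ letterPerm S σ a :: z) := by
          have := admissible_localAct hσ hw
          rwa [localAct_append_cons] at this
        rw [h_conj_h hv hσ hw hρ hw₂ (by rwa [label_append_letterPerm])]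
        refine h_mem_wordSubgroup ?_
        simp only [List.length_append, List.length_cons] at hk hm
        simp only [Set.mem_ofPred_eq, List.length_append, List.length_cons]
        omega
      · rw [h_comm hv hσ hw hρ (by omega) hvw, mul_inv_cancel_right]
        exact h_mem_wordSubgroup ⟨hk, hm⟩) hg
    have hl1 : l = 1 := by
      refine eq_one_of_mem_wordSubgroup_length hl fun v hv => ?_
      have hrv : r • v = v := smul_eq_of_mem_wordSubgroup
        (fun w hw σ => localAct_of_length_le _ (by have := hw.1; omega)) hr
      have := hfix v
      rwa [mul_smul, hrv] at this
    rw [hl1, one_mul] at hfix ⊢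
    exact ih (k := k + 1) (g := r) hr hfix

theorem eq_one_of_mem_base {g : Lam ι S} (hg : g ∈ base ι S)
    (hfix : ∀ v : Vertex ι, g • v = v) : g = 1 := by
  obtain ⟨m, hm⟩ : ∃ m, g ∈ wordSubgroup ι S {w | 0 ≤ w.length ∧ w.length < 0 + m} := by
    clear hfix
    have hmono : ∀ {m n : ℕ}, m ≤ n → {w : List (Letter I) | 0 ≤ w.length ∧ w.length < 0 + m} ⊆
        {w | 0 ≤ w.length ∧ w.length < 0 + n} := fun hmn w hw => ⟨hw.1, by have := hw.2; omega⟩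
    induction hg using Subgroup.closure_induction with
    | mem g hg =>
      obtain ⟨x, rfl⟩ := hg
      exact ⟨x.word.length + 1, h_mem_wordSubgroup ⟨Nat.zero_le _, by omega⟩⟩
    | one => exact ⟨0, one_mem _⟩
    | mul a b _ _ ha hb =>
      obtain ⟨m, ha⟩ := ha
      obtain ⟨n, hb⟩ := hb
      exact ⟨max m n, mul_mem (wordSubgroup_mono (hmono (le_max_left _ _)) ha)
        (wordSubgroup_mono (hmono (le_max_right _ _)) hb)⟩
    | inv a _ ha =>
      obtain ⟨m, ha⟩ := ha
      exact ⟨m, inv_mem ha⟩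
  exact eq_one_of_mem_wordSubgroup_of_smul hm hfix

variable [∀ ε, MulAction.IsPretransitive (S ε) (I ε)]

/-- The action of `Λ` on the tree is faithful: an element that acts trivially fixes the root, hence
lies in `G`, and `G` acts faithfully. -/
theorem eq_one_of_smul {g : Lam ι S} (hfix : ∀ v : Vertex ι, g • v = v) : g = 1 :=
  eq_one_of_mem_base (mem_base_of_smul_root (hfix _)) hfix

end Faithful

section WreathLemmas

variable {A : Type u} [CommGroup A]

/-! ### The homomorphism to the wreath product -/

theorem shift_single (n : Multiplicative ℤ) (m : ℤ) (a : Additive A) :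
    shift A n (Multiplicative.ofAdd (Finsupp.single m a)) =
      Multiplicative.ofAdd (Finsupp.single (m + n.toAdd) a) := by
  change Multiplicative.ofAdd (Finsupp.domCongr (Equiv.addRight n.toAdd) (Finsupp.single m a)) = _
  simp

theorem Wreath.lamp_mul (m : ℤ) (a b : A) :
    Wreath.lamp m (a * b) = Wreath.lamp m a * Wreath.lamp m b := by
  simp only [Wreath.lamp, ← map_mul, ofMul_mul, Finsupp.single_add, ofAdd_add]

theorem Wreath.lamp_comm (m k : ℤ) (a b : A) :
    Wreath.lamp m a * Wreath.lamp k b = Wreath.lamp k b * Wreath.lamp m a := by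
  simp only [Wreath.lamp, ← map_mul]
  rw [mul_comm]

@[simp]
theorem Wreath.lamp_right (m : ℤ) (a : A) : (Wreath.lamp m a).right = 1 := rfl

@[simp]
theorem Wreath.gen_right : (Wreath.gen A).right = Multiplicative.ofAdd 1 := rfl

/-- Conjugation of a lamp by `x` only depends on the component of `x` in `ℤ`, since the base
group is commutative. -/
theorem Wreath.conj_lamp (x : Wreath A) (m : ℤ) (a : A) :
    x * Wreath.lamp m a * x⁻¹ = Wreath.lamp (m + x.right.toAdd) a := by
  rw [mul_inv_eq_iff_eq_mul]
  refine SemidirectProduct.ext ?_ ?_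
  · change x.left * shift A x.right _ = _ * shift A 1 x.left
    rw [map_one, MulAut.one_apply, mul_comm]
    congr 1
    exact shift_single _ _ _
  · simp

theorem Wreath.gen_zpow_right (k : ℤ) : (Wreath.gen A ^ k).right = Multiplicative.ofAdd k := by
  have := map_zpow (SemidirectProduct.rightHom (φ := shift A)) (Wreath.gen A) k
  rw [SemidirectProduct.rightHom_eq_right] at this
  rw [this, Wreath.gen_right, ← ofAdd_zsmul, smul_eq_mul, mul_one]

theorem Wreath.gen_zpow_conj_lamp (k m : ℤ) (a : A) :
    Wreath.gen A ^ k * Wreath.lamp m a * (Wreath.gen A ^ k)⁻¹ = Wreath.lamp (m + k) a := by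
  rw [Wreath.conj_lamp, Wreath.gen_zpow_right, toAdd_ofAdd]

/-- Homomorphisms on the base group are determined by their values on the lamps. -/
theorem hom_base_ext {K : Type*} [Group K] {f g : Multiplicative (ℤ →₀ Additive A) →* K}
    (hfg : ∀ m a, f (Multiplicative.ofAdd (Finsupp.single m a)) =
      g (Multiplicative.ofAdd (Finsupp.single m a))) : f = g := by
  refine MonoidHom.ext fun x => ?_
  change f (Multiplicative.ofAdd x.toAdd) = g (Multiplicative.ofAdd x.toAdd)
  generalize x.toAdd = x
  induction x using Finsupp.induction_linear with
  | zero => rw [ofAdd_zero, map_one, map_one]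
  | add x y hx hy => rw [ofAdd_add, map_mul, map_mul, hx, hy]
  | single m a => exact hfg m a

/-- A homomorphism from a group `G` to `K` and an element `t` of `K` extend to the wreath product
of the abelianization of `G` by `ℤ` if the images of `G` under conjugation by the various powers of
`t` commute. The case `m = 0` of the hypothesis says that the image of `G` itself is abelian. -/
theorem Wreath.exists_hom_of_commute {G : Type u} [Group G] {K : Type*} [Group K] (φ : G →* K)
    (t : K) (hcomm : ∀ (m : ℤ) (σ ρ : G), Commute (φ σ) (t ^ m * φ ρ * (t ^ m)⁻¹)) :
    ∃ ψ : Wreath (Abelianization G) →* K,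
      (∀ σ, ψ (Wreath.lamp 0 (Abelianization.of σ)) = φ σ) ∧ ψ (Wreath.gen _) = t := by
  set f : ℤ → G →* K := fun m => (MulAut.conj (t ^ m)).toMonoidHom.comp φ with hf
  have hfapp : ∀ m σ, f m σ = t ^ m * φ σ * (t ^ m)⁻¹ := fun m σ => rfl
  have hconj : ∀ k m σ, t ^ k * f m σ * (t ^ k)⁻¹ = f (m + k) σ := by
    intro k m σ
    rw [hfapp, hfapp, add_comm, zpow_add]
    group
  have hff : ∀ m k σ ρ, f m σ * f k ρ = f k ρ * f m σ := by
    intro m k σ ρ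
    have h₁ := (hcomm (k - m) σ ρ).map (MulAut.conj (t ^ m)).toMonoidHom
    have h₂ : MulAut.conj (t ^ m) (t ^ (k - m) * φ ρ * (t ^ (k - m))⁻¹) = f k ρ := by
      rw [MulAut.conj_apply, ← hfapp, hconj, sub_add_cancel]
    change f m σ * MulAut.conj (t ^ m) (t ^ (k - m) * φ ρ * (t ^ (k - m))⁻¹) =
      MulAut.conj (t ^ m) (t ^ (k - m) * φ ρ * (t ^ (k - m))⁻¹) * f m σ at h₁
    rwa [h₂] at h₁
  -- The values of the homomorphisms `f m` generate an abelian group.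
  set P : Subgroup K := Subgroup.closure {x | ∃ m σ, x = f m σ}
  have : IsMulCommutative P := Subgroup.isMulCommutative_closure (by
    rintro _ ⟨m, σ, rfl⟩ _ ⟨k, ρ, rfl⟩
    exact hff m k σ ρ)
  let _ : CommGroup P := { (inferInstance : Group P) with mul_comm := mul_comm' }
  let fP : ℤ → Abelianization G →* P := fun m =>
    Abelianization.lift ((f m).codRestrict P fun σ => Subgroup.subset_closure ⟨m, σ, rfl⟩)
  let F : Multiplicative (ℤ →₀ Additive (Abelianization G)) →* P :=
    AddMonoidHom.toMultiplicativeLeft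
      (Finsupp.liftAddHom fun m => MonoidHom.toAdditive (fP m))
  have hF : ∀ m σ, (F (Multiplicative.ofAdd
      (Finsupp.single m (Additive.ofMul (Abelianization.of σ)))) : K) = f m σ := by
    intro m σ
    have h₁ : F (Multiplicative.ofAdd
        (Finsupp.single m (Additive.ofMul (Abelianization.of σ)))) =
        fP m (Abelianization.of σ) := by
      change Additive.toMul (Finsupp.liftAddHom _ (Finsupp.single m _)) = _
      rw [Finsupp.liftAddHom_apply_single]
      rfl
    rw [h₁]
    change ((Abelianization.lift ((f m).codRestrict P _) (Abelianization.of σ) : P) : K) = f m σ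
    rw [Abelianization.lift_apply_of]
    rfl
  refine ⟨SemidirectProduct.lift (P.subtype.comp F) (zpowersHom K t) fun n => ?_, fun σ => ?_, ?_⟩
  · refine hom_base_ext fun m a => ?_
    obtain ⟨σ, hσ⟩ := QuotientGroup.mk_surjective a.toMul
    obtain rfl : Additive.ofMul (Abelianization.of σ) = a := congrArg Additive.ofMul hσ
    change (F (shift _ n (Multiplicative.ofAdd (Finsupp.single m _))) : K) =
      MulAut.conj (zpowersHom K t n) (F (Multiplicative.ofAdd (Finsupp.single m _)))
    rw [shift_single, hF, hF, MulAut.conj_apply, zpowersHom_apply, hconj]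
  · rw [Wreath.lamp, SemidirectProduct.lift_inl]
    refine (hF 0 σ).trans ?_
    rw [hfapp, zpow_zero, one_mul, inv_one, mul_one]
  · rw [Wreath.gen, SemidirectProduct.lift_inr, zpowersHom_apply, toAdd_ofAdd, zpow_one]

end WreathLemmas

section Eta

variable {I : ℤˣ → Type u} {ι : ∀ ε, I ε} {S : ∀ ε, Subgroup (Equiv.Perm (I ε))}

theorem height_cons (a : Letter I) (w : List (Letter I)) :
    height (a :: w) = (a.1 : ℤ) + height w := by
  simp [height]

theorem height_append (v w : List (Letter I)) : height (v ++ w) = height v + height w := by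
  simp [height]

/-- The images in the wreath product of the generators of `Λ`. -/
noncomputable def genWreath : Gen ι S → Wreath (Abelianization (Gam S))
  | .tau => Wreath.gen _
  | .symb x => Wreath.lamp (height x.word) (Abelianization.of x.perm)

theorem genWreath_rel {a b : FreeGroup (Gen ι S)} (hab : Rel ι S a b) :
    FreeGroup.lift genWreath a = FreeGroup.lift genWreath b := by
  have hneg : ∀ k : ℤ, Wreath.gen (Abelianization (Gam S)) ^ k =
      (Wreath.gen (Abelianization (Gam S)) ^ (-k))⁻¹ := fun k => by rw [zpow_neg, inv_inv]
  cases hab with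
  | r1 s t =>
    simp only [map_mul, fh, fh₀, FreeGroup.lift_apply_of, genWreath]
    exact Wreath.lamp_comm _ _ _ _
  | r2 v w u σ σ' hv hσ' hwu hσ hne hlen hvw =>
    simp only [map_mul, fh, FreeGroup.lift_apply_of, genWreath]
    exact Wreath.lamp_comm _ _ _ _
  | r3 w u ε i σ σ' hw hσ h₁ hσ' h₂ hσ'₂ hne =>
    simp only [map_mul, map_inv, fh, FreeGroup.lift_apply_of, genWreath]
    rw [Wreath.conj_lamp]
    simp [height_append, height_cons]
  | r4 w σ σ' hw hσ hσ' hσσ' hne =>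
    simp only [map_mul, fh, FreeGroup.lift_apply_of, genWreath]
    exact (Wreath.lamp_mul _ _ _).symm
  | r5 σ σ' =>
    simp only [map_mul, fh, fh₀, FreeGroup.lift_apply_of, genWreath]
    exact (Wreath.lamp_mul _ _ _).symm
  | r6 u ε i σ σ' h₁ hσ' h₂ hσ'₂ =>
    simp only [map_mul, map_inv, fh, fh₀, FreeGroup.lift_apply_of, genWreath]
    rw [Wreath.conj_lamp]
    simp [height_cons]
  | r7 ε σ h₁ hσ =>
    simp only [map_mul, map_zpow, fτ, fh, fh₀, FreeGroup.lift_apply_of, genWreath]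
    rw [zpow_neg, Wreath.gen_zpow_conj_lamp]
    simp [height]
  | r8 ε i u σ h₁ hσ h₂ hσ₂ =>
    simp only [map_mul, map_zpow, fτ, fh, FreeGroup.lift_apply_of, genWreath]
    rw [zpow_neg, Wreath.gen_zpow_conj_lamp]
    simp only [height_cons]
    congr 1
    ring
  | r9_eq ε u σ h₁ hσ h₂ hσ₂ =>
    simp only [map_mul, map_zpow, fτ, fh, FreeGroup.lift_apply_of, genWreath]
    rw [hneg ε, Wreath.gen_zpow_conj_lamp]
    simp only [height_cons]
    congr 1
    ring
  | r9_ne ε i u σ h₁ hσ h₂ hσ₂ hi =>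
    simp only [map_mul, map_zpow, fτ, fh, FreeGroup.lift_apply_of, genWreath]
    rw [hneg ε, Wreath.gen_zpow_conj_lamp]
    simp only [height_cons, Units.val_neg]
    congr 1
    ring

variable (ι S) in
/-- The homomorphism `η` from `Λ` to the wreath product. -/
noncomputable def eta : Lam ι S →* Wreath (Abelianization (Gam S)) :=
  PresentedGroup.toGroup (f := genWreath) (by
    rintro _ ⟨a, b, hab, rfl⟩
    rw [map_mul, map_inv, genWreath_rel hab, mul_inv_cancel])

theorem eta_τ : eta ι S (τ ι S) = Wreath.gen _ := PresentedGroup.toGroup.of _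

theorem eta_h (x : Symb ι S) :
    eta ι S (h ι S x) = Wreath.lamp (height x.word) (Abelianization.of x.perm) :=
  PresentedGroup.toGroup.of _

theorem eta_h₀ (σ : Gam S) : eta ι S (h₀ ι S σ) = Wreath.lamp 0 (Abelianization.of σ) :=
  eta_h _

variable (ι S) in
/-- The homomorphism `Λ → ℤ` which measures how far an element of `Λ` shifts the height. -/
noncomputable def shiftHom : Lam ι S →* Multiplicative ℤ :=
  SemidirectProduct.rightHom.comp (eta ι S)

theorem shiftHom_apply (g : Lam ι S) : shiftHom ι S g = (eta ι S g).right := rfl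

@[simp]
theorem shiftHom_h₀ (σ : Gam S) : shiftHom ι S (h₀ ι S σ) = 1 := by
  rw [shiftHom_apply, eta_h₀, Wreath.lamp_right]

@[simp]
theorem shiftHom_τ : shiftHom ι S (τ ι S) = Multiplicative.ofAdd 1 := by
  rw [shiftHom_apply, eta_τ, Wreath.gen_right]

theorem shiftHom_τ_zpow (n : ℤ) : shiftHom ι S (τ ι S ^ n) = Multiplicative.ofAdd n := by
  rw [map_zpow, shiftHom_τ, ← ofAdd_zsmul, smul_eq_mul, mul_one]

theorem eta_conj_h₀ (g : Lam ι S) (σ : Gam S) :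
    eta ι S (g * h₀ ι S σ * g⁻¹) =
      Wreath.lamp (shiftHom ι S g).toAdd (Abelianization.of σ) := by
  rw [map_mul, map_mul, map_inv, eta_h₀, Wreath.conj_lamp, zero_add, shiftHom_apply]

theorem eta_eq_inl {g : Lam ι S} (hg : shiftHom ι S g = 1) :
    eta ι S g = SemidirectProduct.inl (eta ι S g).left := by
  refine SemidirectProduct.ext ?_ ?_
  · rw [SemidirectProduct.left_inl]
  · rw [SemidirectProduct.right_inl]
    exact hg

/-- Elements of `Λ` that do not shift the height have commuting images under `η`. -/
theorem eta_comm {g k : Lam ι S} (hg : shiftHom ι S g = 1) (hk : shiftHom ι S k = 1) :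
    eta ι S g * eta ι S k = eta ι S k * eta ι S g := by
  rw [eta_eq_inl hg, eta_eq_inl hk, ← map_mul, ← map_mul, mul_comm]

/-- The base group of the wreath product is generated by the lamps. -/
theorem inl_mem_of_lamp_mem {A : Type u} [CommGroup A] (K : Subgroup (Wreath A))
    (hK : ∀ m a, Wreath.lamp m a ∈ K) (f : Multiplicative (ℤ →₀ Additive A)) :
    (SemidirectProduct.inl f : Wreath A) ∈ K := by
  change SemidirectProduct.inl (Multiplicative.ofAdd f.toAdd) ∈ K
  generalize f.toAdd = f
  induction f using Finsupp.induction_linear with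
  | zero => simp
  | add f g hf hg =>
    rw [ofAdd_add, map_mul]
    exact mul_mem hf hg
  | single m a => exact hK m a.toMul

theorem eta_surjective : Function.Surjective (eta ι S) := by
  rw [← MonoidHom.range_eq_top, eq_top_iff]
  have hτ : ∀ k : ℤ, eta ι S (τ ι S ^ k) = Wreath.gen _ ^ k := fun k => by rw [map_zpow, eta_τ]
  have hl : ∀ m a, Wreath.lamp m a ∈ (eta ι S).range := by
    intro m a
    obtain ⟨σ, rfl⟩ := QuotientGroup.mk_surjective a
    refine ⟨τ ι S ^ m * h₀ ι S σ * (τ ι S ^ m)⁻¹, ?_⟩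
    rw [eta_conj_h₀, shiftHom_τ_zpow]
    rfl
  intro x _
  rw [← SemidirectProduct.inl_left_mul_inr_right x]
  refine mul_mem (inl_mem_of_lamp_mem _ hl _) ⟨τ ι S ^ x.right.toAdd, ?_⟩
  rw [hτ, Wreath.gen, ← map_zpow, ← ofAdd_zsmul, smul_eq_mul, mul_one, ofAdd_toAdd]

end Eta

section HalfTrees

open scoped Pointwise

variable {I : ℤˣ → Type u} {ι : ∀ ε, I ε} {S : ∀ ε, Subgroup (Equiv.Perm (I ε))}

/-! ### Branches and half-trees -/

variable (ι) in
/-- The branch at the root in the direction of the letter `a`. -/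
def branch (a : Letter I) : Set (Vertex ι) := {v | v.1.head? = some a}

theorem mem_branch {a : Letter I} {v : Vertex ι} : v ∈ branch ι a ↔ v.1.head? = some a := Iff.rfl

theorem disjoint_branch {a b : Letter I} (hab : a ≠ b) : Disjoint (branch ι a) (branch ι b) :=
  Set.disjoint_left.2 fun _ ha hb => hab (Option.some.inj (ha.symm.trans hb))

theorem branch_subset_compl {a b : Letter I} (hab : a ≠ b) : branch ι a ⊆ (branch ι b)ᶜ :=
  (disjoint_branch hab).subset_compl_right

theorem smul_set_subset_of {X : Type*} {G : Type*} [Group G] [MulAction G X] {g : G}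
    {A B : Set X} (hg : ∀ v ∈ A, g • v ∈ B) : g • A ⊆ B := by
  rintro _ ⟨v, hv, rfl⟩
  exact hg v hv

theorem h₀_smul_branch (σ : Gam S) (a : Letter I) :
    h₀ ι S σ • branch ι a = branch ι (letterPerm S σ a) := by
  have key : ∀ (σ : Gam S) (a : Letter I),
      h₀ ι S σ • branch ι a ⊆ branch ι (letterPerm S σ a) := by
    intro σ a
    refine smul_set_subset_of fun v hv => ?_
    rw [mem_branch, h₀_smul_val]
    rcases hz : v.1 with _ | ⟨b, z⟩
    · simp [mem_branch, hz] at hv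
    · obtain rfl : b = a := by simpa [mem_branch, hz] using hv
      simp
  refine (key σ a).antisymm ?_
  rw [Set.subset_smul_set_iff, ← h₀_inv]
  refine (key _ _).trans_eq ?_
  rw [← Equiv.Perm.mul_apply, ← map_mul, inv_mul_cancel, map_one, Equiv.Perm.one_apply]

/-- An edge of the axis splits the tree into two half-trees. -/
theorem τ_zpow_smul_branch (ε : ℤˣ) :
    τ ι S ^ (ε : ℤ) • branch ι (axisLetter ι (-ε)) = (branch ι (axisLetter ι ε))ᶜ := by
  ext v
  have hv : τ ι S ^ ((-ε : ℤˣ) : ℤ) • v = axisPerm ι (-ε) v := τ_zpow_smul (-ε) v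
  rw [Units.val_neg, zpow_neg] at hv
  rw [Set.mem_smul_set_iff_inv_smul_mem, hv, mem_branch, axisPerm_val, Set.mem_compl_iff,
    mem_branch]
  by_cases h : ∀ b ∈ v.1.head?, b ≠ axisLetter ι (- -ε)
  · rw [consAxis_of_ne h]
    rw [neg_neg] at h
    simpa using fun hb => h _ hb rfl
  · obtain ⟨b, hb, rfl⟩ : ∃ b ∈ v.1.head?, b = axisLetter ι (- -ε) := by simpa using h
    rcases hz : v.1 with _ | ⟨c, z⟩
    · simp [hz] at hb
    · obtain rfl : c = axisLetter ι (- -ε) := by simpa [hz] using hb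
      have hadm := v.2
      rw [hz] at hadm
      have := (admissible_cons.1 hadm).1
      simp only [axisLetter_fst] at this
      rw [consAxis_cons_axisLetter]
      rw [neg_neg] at this ⊢
      simpa using fun hb => this _ hb rfl

/-- Translating along the axis in the direction of a half-tree shrinks it. -/
theorem τ_zpow_smul_branch_subset {δ : ℤˣ} {n : ℤ} (hn : 0 ≤ (δ : ℤ) * n) :
    τ ι S ^ n • branch ι (axisLetter ι δ) ⊆ branch ι (axisLetter ι δ) := by
  have hstep : τ ι S ^ (δ : ℤ) • branch ι (axisLetter ι δ) ⊆ branch ι (axisLetter ι δ) := by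
    have := τ_zpow_smul_branch (ι := ι) (S := S) (-δ)
    rw [neg_neg, Units.val_neg, zpow_neg] at this
    rw [Set.smul_set_subset_iff_subset_inv_smul_set, this]
    exact branch_subset_compl (axisLetter_neg_ne ι δ).symm
  have hpow : ∀ k : ℕ, (τ ι S ^ (δ : ℤ)) ^ k • branch ι (axisLetter ι δ) ⊆
      branch ι (axisLetter ι δ) := by
    intro k
    induction k with
    | zero => simp
    | succ k ih =>
      rw [pow_succ, mul_smul]
      exact (Set.smul_set_mono hstep).trans ih
  obtain ⟨k, hk⟩ := Int.eq_ofNat_of_zero_le hn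
  have hδ : (δ : ℤ) * δ = 1 := by rw [← Units.val_mul, Int.units_mul_self, Units.val_one]
  have : n = (δ : ℤ) * k := by rw [← hk, ← mul_assoc, hδ, one_mul]
  rw [this, zpow_mul, zpow_natCast]
  exact hpow k

theorem τ_zpow_smul_branch_subset_branch {δ : ℤˣ} {a : Letter I} (ha : a ≠ axisLetter ι (-δ)) :
    τ ι S ^ (δ : ℤ) • branch ι a ⊆ branch ι (axisLetter ι δ) := by
  have := congrArg compl (τ_zpow_smul_branch (ι := ι) (S := S) δ)
  rw [compl_compl, ← Set.smul_set_compl] at this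
  rw [← this]
  exact Set.smul_set_mono (branch_subset_compl ha)

/-- The elements of `G` permute the branches at the root. -/
theorem exists_smul_branch_of_mem_base {k : Lam ι S} (hk : k ∈ base ι S) :
    ∃ σ : Gam S, ∀ a : Letter I, k • branch ι a = branch ι (letterPerm S σ a) := by
  induction hk using Subgroup.closure_induction with
  | mem g hg =>
    obtain ⟨⟨w, σ, hw, hσ⟩, rfl⟩ := hg
    rcases w with _ | ⟨b, w⟩
    · exact ⟨σ, fun a => h₀_smul_branch σ a⟩
    · have key : ∀ (σ : Gam S) (hσ : σ ∈ label ι S (b :: w)) (a : Letter I),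
          h ι S ⟨b :: w, σ, hw, hσ⟩ • branch ι a ⊆ branch ι a := by
        intro σ hσ a
        refine smul_set_subset_of fun v hv => ?_
        rw [mem_branch, h_smul_val]
        dsimp only
        rwa [head?_localAct_cons]
      refine ⟨1, fun a => ?_⟩
      rw [map_one, Equiv.Perm.one_apply]
      refine (key σ hσ a).antisymm ?_
      rw [Set.subset_smul_set_iff, h_inv]
      exact key _ _ _
  | one => exact ⟨1, fun a => by rw [one_smul, map_one, Equiv.Perm.one_apply]⟩
  | mul x y _ _ hx hy =>
    obtain ⟨σ, hσ⟩ := hx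
    obtain ⟨ρ, hρ⟩ := hy
    exact ⟨σ * ρ, fun a => by rw [mul_smul, hρ, hσ, map_mul, Equiv.Perm.mul_apply]⟩
  | inv x _ hx =>
    obtain ⟨σ, hσ⟩ := hx
    refine ⟨σ⁻¹, fun a => ?_⟩
    rw [inv_smul_eq_iff, hσ, ← Equiv.Perm.mul_apply, ← map_mul, mul_inv_cancel, map_one,
      Equiv.Perm.one_apply]

variable (S) in
/-- The half-trees are the translates of the branches at the root along the axis. -/
def IsHalfTree (B : Set (Vertex ι)) : Prop :=
  ∃ (g : Lam ι S) (ε : ℤˣ), B = g • branch ι (axisLetter ι ε)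

theorem IsHalfTree.smul {B : Set (Vertex ι)} (hB : IsHalfTree S B) (g : Lam ι S) :
    IsHalfTree S (g • B) := by
  obtain ⟨k, ε, rfl⟩ := hB
  exact ⟨g * k, ε, smul_smul _ _ _⟩

theorem IsHalfTree.compl {B : Set (Vertex ι)} (hB : IsHalfTree S B) : IsHalfTree S Bᶜ := by
  obtain ⟨g, ε, rfl⟩ := hB
  refine ⟨g * τ ι S ^ (ε : ℤ), -ε, ?_⟩
  rw [mul_smul, τ_zpow_smul_branch, Set.smul_set_compl]

theorem isHalfTree_branch [∀ ε, MulAction.IsPretransitive (S ε) (I ε)] (a : Letter I) :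
    IsHalfTree S (branch ι a) :=
  ⟨h₀ ι S (letterRep (ι := ι) S a), a.1, by rw [h₀_smul_branch, letterPerm_letterRep]⟩

/-! ### Rigid stabilizers -/

variable (S) in
/-- The rigid stabilizer of a set `B` of vertices: the elements of `Λ` that do not shift the height
and fix all vertices outside `B`. Including the condition on the height makes `η` of these elements
lie in the base group by definition. -/
noncomputable def rist (B : Set (Vertex ι)) : Subgroup (Lam ι S) :=
  fixingSubgroup (Lam ι S) Bᶜ ⊓ (shiftHom ι S).ker

theorem mem_rist {B : Set (Vertex ι)} {g : Lam ι S} :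
    g ∈ rist S B ↔ (∀ v ∉ B, g • v = v) ∧ shiftHom ι S g = 1 := by
  rw [rist, Subgroup.mem_inf, mem_fixingSubgroup_iff, MonoidHom.mem_ker]
  rfl

theorem rist_mono {B C : Set (Vertex ι)} (hBC : B ⊆ C) : rist S B ≤ rist S C := fun _ hg =>
  mem_rist.2 ⟨fun v hv => (mem_rist.1 hg).1 v fun h => hv (hBC h), (mem_rist.1 hg).2⟩

theorem shiftHom_conj (k g : Lam ι S) : shiftHom ι S (k * g * k⁻¹) = shiftHom ι S g := by
  rw [map_mul, map_mul, map_inv, mul_inv_cancel_comm]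

theorem conj_mem_rist {B : Set (Vertex ι)} {g : Lam ι S} (hg : g ∈ rist S B) (k : Lam ι S) :
    k * g * k⁻¹ ∈ rist S (k • B) := by
  refine mem_rist.2 ⟨fun v hv => ?_, by rw [shiftHom_conj, (mem_rist.1 hg).2]⟩
  rw [mul_smul, mul_smul, (mem_rist.1 hg).1 _ (fun h => hv (Set.mem_smul_set_iff_inv_smul_mem.2 h)),
    smul_inv_smul]

theorem smul_eq_of_mem_rist_compl {B : Set (Vertex ι)} {g : Lam ι S} (hg : g ∈ rist S Bᶜ) :
    g • B = B := by
  have : ∀ v ∈ B, g • v = v := fun v hv => (mem_rist.1 hg).1 v (fun h => h hv)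
  ext v
  constructor
  · rintro ⟨w, hw, rfl⟩
    change g • w ∈ B
    rwa [this w hw]
  · exact fun hv => ⟨v, hv, this v hv⟩

theorem smul_mem_of_mem_rist {B : Set (Vertex ι)} {g : Lam ι S} (hg : g ∈ rist S B) {v : Vertex ι}
    (hv : v ∈ B) : g • v ∈ B := by
  by_contra h
  have := (mem_rist.1 hg).1 _ h
  rw [MulAction.injective g this] at h
  exact h hv

theorem h₀_mem_rist {σ : Gam S} {a : Letter I} (ha : letterPerm S σ a = a) :
    h₀ ι S σ ∈ rist S (branch ι a)ᶜ := by
  refine mem_rist.2 ⟨fun v hv => Subtype.ext ?_, shiftHom_h₀ σ⟩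
  rw [Set.notMem_compl_iff, mem_branch] at hv
  rw [h₀_smul_val]
  rcases hz : v.1 with _ | ⟨b, z⟩
  · simp
  · obtain rfl : b = a := by simpa [hz] using hv
    rw [localAct_nil_cons, ha]

variable [∀ ε, MulAction.IsPretransitive (S ε) (I ε)]

/-- Elements with disjoint supports commute, since `Λ` acts faithfully. -/
theorem commute_of_mem_rist {B C : Set (Vertex ι)} (hBC : Disjoint B C) {a b : Lam ι S}
    (ha : a ∈ rist S B) (hb : b ∈ rist S C) : Commute a b := by
  have key : ∀ v : Vertex ι, (a * b) • v = (b * a) • v := by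
    intro v
    rw [mul_smul, mul_smul]
    by_cases hvB : v ∈ B
    · rw [(mem_rist.1 hb).1 v (Set.disjoint_left.1 hBC hvB),
        (mem_rist.1 hb).1 _ (Set.disjoint_left.1 hBC (smul_mem_of_mem_rist ha hvB))]
    · rw [(mem_rist.1 ha).1 v hvB]
      by_cases hvC : v ∈ C
      · exact (mem_rist.1 ha).1 _ (Set.disjoint_right.1 hBC (smul_mem_of_mem_rist hb hvC))
      · rw [(mem_rist.1 hb).1 v hvC, (mem_rist.1 ha).1 v hvB]
  have : (b * a)⁻¹ * (a * b) = 1 := eq_one_of_smul fun v => by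
    rw [mul_smul, key, inv_smul_smul]
  exact (inv_mul_eq_one.1 this).symm

/-! ### Moving half-trees -/

/-- Every half-tree at the root along the axis can be moved into every other one, with an arbitrary
shift of the height. -/
theorem exists_smul_branch_subset (hI : ∀ ε, ∃ i : I ε, i ≠ ι ε) (δ ε : ℤˣ)
    (m : Multiplicative ℤ) :
    ∃ r : Lam ι S, shiftHom ι S r = m ∧
      r • branch ι (axisLetter ι ε) ⊆ branch ι (axisLetter ι δ) := by
  -- Turning around: step off the axis.
  have turn : ∀ δ : ℤˣ, ∃ r : Lam ι S, shiftHom ι S r = Multiplicative.ofAdd (δ : ℤ) ∧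
      r • branch ι (axisLetter ι (-δ)) ⊆ branch ι (axisLetter ι δ) := by
    intro δ
    obtain ⟨b, hb, hne⟩ := exists_letter_ne hI (-δ)
    obtain ⟨s, hs⟩ := exists_letterPerm_eq (S := S) (axisLetter ι (-δ)) b hb.symm
    refine ⟨τ ι S ^ (δ : ℤ) * h₀ ι S (Pi.mulSingle _ s), ?_, ?_⟩
    · rw [map_mul, shiftHom_h₀, mul_one, shiftHom_τ_zpow]
    · rw [mul_smul, h₀_smul_branch, hs]
      exact τ_zpow_smul_branch_subset_branch hne
  have opp : ∀ (δ : ℤˣ) (m : Multiplicative ℤ), ∃ r : Lam ι S, shiftHom ι S r = m ∧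
      r • branch ι (axisLetter ι (-δ)) ⊆ branch ι (axisLetter ι δ) := by
    intro δ m
    obtain ⟨r, hr, hsub⟩ := turn δ
    -- Translate by `n` before or after the turn, according to the sign.
    set n : ℤ := m.toAdd - δ with hn
    have hm : Multiplicative.ofAdd (δ : ℤ) * Multiplicative.ofAdd n = m := by
      rw [← ofAdd_add, hn, add_sub_cancel, ofAdd_toAdd]
    rcases le_total 0 ((δ : ℤ) * n) with h | h
    · refine ⟨τ ι S ^ n * r, ?_, ?_⟩
      · rw [map_mul, shiftHom_τ_zpow, hr, mul_comm, hm]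
      · rw [mul_smul]
        exact (Set.smul_set_mono hsub).trans (τ_zpow_smul_branch_subset h)
    · refine ⟨r * τ ι S ^ n, ?_, ?_⟩
      · rw [map_mul, shiftHom_τ_zpow, hr, hm]
      · rw [mul_smul]
        refine (Set.smul_set_mono (τ_zpow_smul_branch_subset ?_)).trans hsub
        rw [Units.val_neg]
        linarith
  rcases Int.units_eq_one_or (ε * δ) with h | h
  · obtain rfl : ε = δ := by
      rw [← mul_one ε, ← Int.units_mul_self δ, ← mul_assoc, h, one_mul]
    obtain ⟨r, hr, hsub⟩ := opp (-ε) 1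
    rw [neg_neg] at hsub
    obtain ⟨q, hq, hsub'⟩ := opp ε m
    refine ⟨q * r, by rw [map_mul, hr, hq, mul_one], ?_⟩
    rw [mul_smul]
    exact (Set.smul_set_mono hsub).trans hsub'
  · obtain rfl : ε = -δ := by
      rw [← mul_one ε, ← Int.units_mul_self δ, ← mul_assoc, h, neg_one_mul]
    exact opp δ m

theorem IsHalfTree.exists_smul_subset (hI : ∀ ε, ∃ i : I ε, i ≠ ι ε) {B C : Set (Vertex ι)}
    (hB : IsHalfTree S B) (hC : IsHalfTree S C) (m : Multiplicative ℤ) :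
    ∃ g : Lam ι S, shiftHom ι S g = m ∧ g • B ⊆ C := by
  obtain ⟨q, ε, rfl⟩ := hB
  obtain ⟨p, δ, rfl⟩ := hC
  obtain ⟨r, hr, hsub⟩ :=
    exists_smul_branch_subset (S := S) hI δ ε ((shiftHom ι S p)⁻¹ * m * shiftHom ι S q)
  refine ⟨p * r * q⁻¹, ?_, ?_⟩
  · rw [map_mul, map_mul, map_inv, hr]
    group
  · rw [smul_smul, inv_mul_cancel_right, mul_smul]
    exact Set.smul_set_mono hsub

/-- Every half-tree contains three disjoint half-trees. -/
theorem IsHalfTree.exists_disjoint (hI : ∀ ε, ∃ i : I ε, i ≠ ι ε) {B : Set (Vertex ι)}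
    (hB : IsHalfTree S B) : ∃ B₁ B₂ B₃ : Set (Vertex ι), IsHalfTree S B₁ ∧ IsHalfTree S B₂ ∧
      IsHalfTree S B₃ ∧ B₁ ⊆ B ∧ B₂ ⊆ B ∧ B₃ ⊆ B ∧ Disjoint B₁ B₂ ∧ Disjoint B₁ B₃ ∧
      Disjoint B₂ B₃ := by
  obtain ⟨p, ε, rfl⟩ := hB
  obtain ⟨b, hb, hbne⟩ := exists_letter_ne hI ε
  obtain ⟨c, hc, hcne⟩ := exists_letter_ne hI (-ε)
  have hbc : b ≠ c := fun h => units_ne_neg ε (hb.symm.trans ((congrArg Sigma.fst h).trans hc))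
  have hac : axisLetter ι ε ≠ c := fun h => units_ne_neg ε ((congrArg Sigma.fst h).trans hc)
  have hb' : b ≠ axisLetter ι (-ε) := fun h =>
    units_ne_neg ε (hb.symm.trans (congrArg Sigma.fst h))
  have hsub : ∀ a : Letter I, a ≠ axisLetter ι (-ε) →
      (p * τ ι S ^ (ε : ℤ)) • branch ι a ⊆ p • branch ι (axisLetter ι ε) := fun a ha => by
    rw [mul_smul]
    exact Set.smul_set_mono (τ_zpow_smul_branch_subset_branch ha)
  refine ⟨_, _, _, (isHalfTree_branch (axisLetter ι ε)).smul (p * τ ι S ^ (ε : ℤ)),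
    (isHalfTree_branch b).smul (p * τ ι S ^ (ε : ℤ)),
    (isHalfTree_branch c).smul (p * τ ι S ^ (ε : ℤ)), hsub _ (axisLetter_neg_ne ι ε).symm,
    hsub _ hb', hsub _ hcne, ?_, ?_, ?_⟩
  · exact Set.disjoint_smul_set.2 (disjoint_branch hbne.symm)
  · exact Set.disjoint_smul_set.2 (disjoint_branch hac)
  · exact Set.disjoint_smul_set.2 (disjoint_branch hbc)

/-- The rigid stabilizer of a half-tree maps onto the base group of the wreath product. -/
theorem IsHalfTree.exists_mem_rist_eta_eq (hI : ∀ ε, ∃ i : I ε, i ≠ ι ε) {C : Set (Vertex ι)}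
    (hC : IsHalfTree S C)
    (f : Multiplicative (ℤ →₀ Additive (Abelianization (Gam S)))) :
    ∃ c ∈ rist S C, eta ι S c = SemidirectProduct.inl f := by
  refine inl_mem_of_lamp_mem ((rist S C).map (eta ι S)) (fun m a => ?_) f
  obtain ⟨σ, rfl⟩ := QuotientGroup.mk_surjective a
  change Wreath.lamp m (Abelianization.of σ) ∈ _
  induction σ using gam_induction with
  | single δ s =>
    have hfix : letterPerm S (Pi.mulSingle (-δ) s) (axisLetter ι (-δ)) = axisLetter ι (-δ) :=
      letterPerm_mulSingle s (units_ne_neg δ).symm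
    obtain ⟨g, hg, hsub⟩ := (isHalfTree_branch (S := S)
      (axisLetter ι (-δ))).compl.exists_smul_subset hI hC (Multiplicative.ofAdd m)
    refine ⟨_, rist_mono hsub (conj_mem_rist (h₀_mem_rist hfix) g), ?_⟩
    rw [eta_conj_h₀, hg, toAdd_ofAdd]
  | mul σ ρ hσ hρ =>
    rw [map_mul, Wreath.lamp_mul]
    exact mul_mem hσ hρ

/-- Every half-tree can be moved into every other one by an element of the kernel of `η`. An
element of the complementary rigid stabilizer corrects the value of `η`. -/
theorem IsHalfTree.exists_mem_ker_smul_subset (hI : ∀ ε, ∃ i : I ε, i ≠ ι ε)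
    {B C : Set (Vertex ι)} (hB : IsHalfTree S B) (hC : IsHalfTree S C) :
    ∃ g ∈ (eta ι S).ker, g • B ⊆ C := by
  obtain ⟨g, hg, hsub⟩ := hB.exists_smul_subset hI hC 1
  obtain ⟨c, hc, hηc⟩ := hB.compl.exists_mem_rist_eta_eq hI (eta ι S g).left⁻¹
  refine ⟨g * c, ?_, ?_⟩
  · rw [MonoidHom.mem_ker, map_mul, hηc, eta_eq_inl hg, ← map_mul, SemidirectProduct.left_inl,
      mul_inv_cancel, map_one]
  · rwa [mul_smul, smul_eq_of_mem_rist_compl hc]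

/-! ### Disjoint translates -/

theorem pathElt_smul_val (w : List (Letter I)) (v : Vertex ι) (hwv : Admissible ι (w ++ v.1)) :
    (pathElt ι S w • v).1 = w ++ v.1 := by
  induction w with
  | nil => simp
  | cons a w ih =>
    have h₁ : ∀ b ∈ (w ++ v.1).head?, b ≠ axisLetter ι (-a.1) := (admissible_cons.1 hwv).1
    have h₂ : Admissible ι (w ++ v.1) := (admissible_cons.1 hwv).2
    rw [pathElt_cons, mul_smul, letterElt, mul_smul, h₀_smul_val, τ_zpow_smul_val, ih h₂,
      consAxis_of_ne h₁, localAct_nil_cons, letterPerm_letterRep, List.cons_append]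

theorem pathElt_smul_root (v : Vertex ι) : pathElt ι S v.1 • root ι = v :=
  Subtype.ext <| by
    rw [pathElt_smul_val _ _ (by simpa [root] using v.2)]
    simp [root]

theorem exists_letter_ne_ne (hI : ∀ ε, ∃ i : I ε, i ≠ ι ε) (b c : Letter I) :
    ∃ a : Letter I, a ≠ b ∧ a ≠ c := by
  obtain ⟨x, hx, hx'⟩ := exists_letter_ne hI 1
  have hy := axisLetter_neg_ne ι 1
  have hxy : x ≠ axisLetter ι (-1) := fun h =>
    units_ne_neg 1 (hx.symm.trans (congrArg Sigma.fst h))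
  by_contra hcon
  push Not at hcon
  by_cases hxb : x = b
  · subst hxb
    exact hy ((hcon _ hxy.symm).trans (hcon _ hx'.symm).symm)
  · obtain rfl := hcon x hxb
    have key : ∀ z : Letter I, x ≠ z → z = b := fun z hz => by
      by_contra hzb
      exact hz (hcon z hzb).symm
    exact hy ((key _ hxy).trans (key _ hx').symm)

/-- Every non-trivial element of `Λ` moves some half-tree off itself. If it moves the vertex `v` to
another vertex, there is such a half-tree at `v`, since at most two of the branches at `v` have to
be avoided: the one towards the image of `v`, and the one mapped onto the branch containing `v`. -/
theorem exists_isHalfTree_disjoint_smul (hI : ∀ ε, ∃ i : I ε, i ≠ ι ε) {n : Lam ι S}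
    (hn : n ≠ 1) : ∃ B : Set (Vertex ι), IsHalfTree S B ∧ Disjoint B (n • B) := by
  obtain ⟨v, hv⟩ : ∃ v : Vertex ι, n • v ≠ v := by
    by_contra hcon
    push Not at hcon
    exact hn (eq_one_of_smul hcon)
  -- Pass to a conjugate of `n` which moves the root.
  set p := pathElt ι S v.1 with hp
  set n' := p⁻¹ * n * p with hn'
  have hw : n' • root ι ≠ root ι := by
    intro h
    rw [hn', mul_smul, mul_smul, inv_smul_eq_iff, hp, pathElt_smul_root] at h
    exact hv h
  obtain ⟨w, hwdef⟩ : ∃ w, n' • root ι = w := ⟨_, rfl⟩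
  have hk := pathElt_inv_mul_mul_mem_base n' (root ι)
  rw [hwdef] at hk hw
  simp only [root, pathElt_nil, mul_one] at hk
  obtain ⟨σ, hσ⟩ := exists_smul_branch_of_mem_base hk
  have hwne : w.1 ≠ [] := fun h => hw (Subtype.ext h)
  obtain ⟨a, ha, ha'⟩ := exists_letter_ne_ne hI (w.1.head hwne)
    ((letterPerm S σ)⁻¹ (axisLetter ι (-(w.1.getLast hwne).1)))
  have hdisj : n' • branch ι a ⊆ branch ι (w.1.head hwne) := by
    have hn'w : n' = pathElt ι S w.1 * ((pathElt ι S w.1)⁻¹ * n') := by group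
    rw [hn'w, mul_smul, hσ]
    refine smul_set_subset_of fun z hz => ?_
    have hadm : Admissible ι (w.1 ++ z.1) := by
      rw [admissible_iff, List.isChain_append]
      refine ⟨(admissible_iff ι).1 w.2, (admissible_iff ι).1 z.2, fun c hc b hb => ?_⟩
      obtain rfl : letterPerm S σ a = b := by
        rw [mem_branch.1 hz] at hb
        simpa using hb
      rw [List.getLast?_eq_some_getLast hwne] at hc
      obtain rfl : w.1.getLast hwne = c := by simpa using hc
      intro h
      exact ha' (Equiv.Perm.eq_inv_iff_eq.2 h)
    rw [mem_branch, pathElt_smul_val _ _ hadm, List.head?_append_of_ne_nil _ hwne,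
      List.head?_eq_some_head hwne]
  refine ⟨p • branch ι a, (isHalfTree_branch a).smul p, ?_⟩
  have hnp : n • p • branch ι a = p • n' • branch ι a := by
    rw [smul_smul, smul_smul, hn']
    group
  rw [hnp]
  exact Set.disjoint_smul_set.2 ((disjoint_branch ha).mono_right hdisj)

end HalfTrees

section Commutators

open scoped Pointwise commutatorElement

variable {I : ℤˣ → Type u} {ι : ∀ ε, I ε} {S : ∀ ε, Subgroup (Equiv.Perm (I ε))}

/-! ### Commutators of rigid stabilizers -/

variable (ι S) in
/-- The subgroup generated by the commutators of elements of the kernel of `η` that are supported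
in a common half-tree. -/
def ristComm : Subgroup (Lam ι S) :=
  Subgroup.closure {g | ∃ B : Set (Vertex ι), IsHalfTree S B ∧
    ∃ a ∈ rist S B ⊓ (eta ι S).ker, ∃ b ∈ rist S B ⊓ (eta ι S).ker, g = ⁅a, b⁆}

theorem IsHalfTree.commutator_mem_ristComm {B : Set (Vertex ι)} (hB : IsHalfTree S B)
    {a b : Lam ι S} (ha : a ∈ rist S B) (ha' : eta ι S a = 1) (hb : b ∈ rist S B)
    (hb' : eta ι S b = 1) : ⁅a, b⁆ ∈ ristComm ι S :=
  Subgroup.subset_closure ⟨B, hB, a, ⟨ha, ha'⟩, b, ⟨hb, hb'⟩, rfl⟩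

instance ristComm_normal : (ristComm ι S).Normal := by
  refine ⟨fun n hn g => ?_⟩
  have : ristComm ι S ≤ (ristComm ι S).comap (MulAut.conj g).toMonoidHom := by
    refine (Subgroup.closure_le _).2 ?_
    rintro _ ⟨B, hB, a, ha, b, hb, rfl⟩
    change MulAut.conj g ⁅a, b⁆ ∈ ristComm ι S
    rw [map_commutatorElement]
    exact (hB.smul g).commutator_mem_ristComm (conj_mem_rist ha.1 g)
      ((inferInstance : (eta ι S).ker.Normal).conj_mem a ha.2 g) (conj_mem_rist hb.1 g)
      ((inferInstance : (eta ι S).ker.Normal).conj_mem b hb.2 g)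
  exact this hn

theorem ristComm_le_ker : ristComm ι S ≤ (eta ι S).ker := by
  refine (Subgroup.closure_le _).2 ?_
  rintro _ ⟨B, -, a, ha, b, hb, rfl⟩
  rw [SetLike.mem_coe, MonoidHom.mem_ker, map_commutatorElement, MonoidHom.mem_ker.1 ha.2,
    commutatorElement_one_left]

theorem commutatorElement_mul_inv_mul_inv {G : Type*} [Group G] {a b c d : G} (hcb : Commute c b)
    (hcd : Commute c d) (hda : Commute d a) : ⁅a * c⁻¹, b * d⁻¹⁆ = ⁅a, b⁆ := by
  have h₁ : c⁻¹ * (b * d⁻¹) = b * d⁻¹ * c⁻¹ :=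
    (hcb.inv_left.mul_right hcd.inv_inv).eq
  have h₂ : d⁻¹ * a⁻¹ = a⁻¹ * d⁻¹ := hda.inv_inv.eq
  calc ⁅a * c⁻¹, b * d⁻¹⁆ = a * (c⁻¹ * (b * d⁻¹)) * c * a⁻¹ * d * b⁻¹ := by
        rw [commutatorElement_def]
        group
    _ = a * b * (d⁻¹ * a⁻¹) * d * b⁻¹ := by
        rw [h₁]
        group
    _ = ⁅a, b⁆ := by
        rw [h₂, commutatorElement_def]
        group

theorem eta_conj_eq {a r : Lam ι S} (ha : shiftHom ι S a = 1) (hr : shiftHom ι S r = 1) :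
    eta ι S (r * a * r⁻¹) = eta ι S a := by
  rw [map_mul, map_mul, eta_comm hr ha, map_inv, mul_inv_cancel_right]

/-- The quotient map onto `Λ / ristComm`. -/
abbrev modRistComm : Lam ι S →* Lam ι S ⧸ ristComm ι S := QuotientGroup.mk' (ristComm ι S)

theorem commute_modRistComm_iff {a b : Lam ι S} :
    Commute (modRistComm a) (modRistComm b) ↔ ⁅a, b⁆ ∈ ristComm ι S := by
  rw [← commutatorElement_eq_one_iff_commute, ← map_commutatorElement]
  exact QuotientGroup.eq_one_iff _

variable [∀ ε, MulAction.IsPretransitive (S ε) (I ε)]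

/-- If `a` and `b` have support in a half-tree `B`, and if `r₁`, `r₂`, `r₃` move `B` to disjoint
subtrees of `B`, then `⁅a, b⁆` is conjugate to the commutator of `a₁ a₂⁻¹` and `b₁ b₃⁻¹`, where
`aᵢ` and `bᵢ` are the conjugates of `a` and `b` by `rᵢ`. -/
theorem IsHalfTree.commute_modRistComm (hI : ∀ ε, ∃ i : I ε, i ≠ ι ε) {B : Set (Vertex ι)}
    (hB : IsHalfTree S B) {a b : Lam ι S}
    (ha : a ∈ rist S B) (hb : b ∈ rist S B) : Commute (modRistComm a) (modRistComm b) := by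
  rw [commute_modRistComm_iff]
  obtain ⟨B₁, B₂, B₃, h₁, h₂, h₃, s₁, s₂, s₃, d₁₂, d₁₃, d₂₃⟩ := hB.exists_disjoint hI
  obtain ⟨r₁, hr₁, t₁⟩ := hB.exists_smul_subset hI h₁ 1
  obtain ⟨r₂, hr₂, t₂⟩ := hB.exists_smul_subset hI h₂ 1
  obtain ⟨r₃, hr₃, t₃⟩ := hB.exists_smul_subset hI h₃ 1
  have mem : ∀ {C : Set (Vertex ι)} {r g : Lam ι S}, r • B ⊆ C → g ∈ rist S B →
      r * g * r⁻¹ ∈ rist S C := fun hC hg => rist_mono hC (conj_mem_rist hg _)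
  have key : ⁅r₁ * a * r₁⁻¹, r₁ * b * r₁⁻¹⁆ ∈ ristComm ι S := by
    rw [← commutatorElement_mul_inv_mul_inv
      (commute_of_mem_rist d₁₂.symm (mem t₂ ha) (mem t₁ hb))
      (commute_of_mem_rist d₂₃ (mem t₂ ha) (mem t₃ hb))
      (commute_of_mem_rist d₁₃.symm (mem t₃ hb) (mem t₁ ha))]
    refine hB.commutator_mem_ristComm ?_ ?_ ?_ ?_
    · exact mul_mem (mem (t₁.trans s₁) ha) (inv_mem (mem (t₂.trans s₂) ha))
    · rw [map_mul, map_inv, eta_conj_eq (mem_rist.1 ha).2 hr₁, eta_conj_eq (mem_rist.1 ha).2 hr₂,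
        mul_inv_cancel]
    · exact mul_mem (mem (t₁.trans s₁) hb) (inv_mem (mem (t₃.trans s₃) hb))
    · rw [map_mul, map_inv, eta_conj_eq (mem_rist.1 hb).2 hr₁, eta_conj_eq (mem_rist.1 hb).2 hr₃,
        mul_inv_cancel]
  have := ristComm_normal.conj_mem _ key r₁⁻¹
  rw [← MulAut.conj_apply, map_commutatorElement, MulAut.conj_apply, MulAut.conj_apply] at this
  convert this using 2 <;> group

/-- If two half-trees cover the tree, then a suitable rotation moves the first one into the second
one, and it commutes modulo `ristComm` with the rigid stabilizer of the first one. -/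
theorem IsHalfTree.commute_modRistComm_of_compl_subset (hI : ∀ ε, ∃ i : I ε, i ≠ ι ε)
    {B C : Set (Vertex ι)} (hB : IsHalfTree S B) (hC : IsHalfTree S C) (hBC : Bᶜ ⊆ C)
    {a b : Lam ι S} (ha : a ∈ rist S B) (hb : b ∈ rist S C) :
    Commute (modRistComm a) (modRistComm b) := by
  -- The rotation `g` about an end of the cut edge fixes another branch at that vertex.
  obtain ⟨p, ε, rfl⟩ := hB
  obtain ⟨c, hc, hcne⟩ := exists_letter_ne hI ε
  obtain ⟨s, hs⟩ := exists_letterPerm_eq (S := S) (axisLetter ι ε) c hc.symm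
  change S (-ε) at s
  change letterPerm S (Pi.mulSingle (-ε) s) _ = c at hs
  set g := p * h₀ ι S (Pi.mulSingle (-ε) s) * p⁻¹ with hg
  have hD : IsHalfTree S (p • (branch ι (axisLetter ι (-ε)))ᶜ) :=
    (isHalfTree_branch _).compl.smul p
  have hgD : g ∈ rist S (p • (branch ι (axisLetter ι (-ε)))ᶜ) :=
    conj_mem_rist (h₀_mem_rist (letterPerm_mulSingle s (units_ne_neg ε).symm)) p
  have hga : Commute (modRistComm g) (modRistComm a) := hD.commute_modRistComm hI hgD
    (rist_mono (Set.smul_set_mono (branch_subset_compl (axisLetter_neg_ne ι ε).symm)) ha)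
  have hgC : g * a * g⁻¹ ∈ rist S C := by
    refine rist_mono (Set.Subset.trans ?_ hBC) (conj_mem_rist ha g)
    rw [hg, smul_smul, inv_mul_cancel_right, mul_smul, h₀_smul_branch, hs, ← Set.smul_set_compl]
    exact Set.smul_set_mono (branch_subset_compl hcne)
  have := hC.commute_modRistComm hI hgC hb
  rwa [map_mul, map_mul, map_inv, hga.eq, mul_inv_cancel_right] at this

/-- Modulo `ristComm`, all the conjugates by powers of `τ` of the `h(σ)`, `σ ∈ Γ`, commute. -/
theorem commute_modRistComm_h₀ (hI : ∀ ε, ∃ i : I ε, i ≠ ι ε) (σ ρ : Gam S) (m : ℤ) :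
    Commute (modRistComm (h₀ ι S σ))
      (modRistComm (τ ι S ^ m * h₀ ι S ρ * (τ ι S ^ m)⁻¹)) := by
  induction σ using gam_induction with
  | mul σ σ' h₁ h₂ =>
    rw [h₀_mul, map_mul]
    exact h₁.mul_left h₂
  | single δ s =>
  induction ρ using gam_induction with
  | mul ρ ρ' h₁ h₂ =>
    rw [h₀_mul, ← MulAut.conj_apply, map_mul, map_mul]
    exact h₁.mul_right h₂
  | single δ' t =>
    have hτ : ∀ ε : ℤˣ, (branch ι (axisLetter ι (-ε)))ᶜ =
        τ ι S ^ (-(ε : ℤ)) • branch ι (axisLetter ι ε) := by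
      intro ε
      have := τ_zpow_smul_branch (ι := ι) (S := S) (-ε)
      rw [neg_neg, Units.val_neg] at this
      exact this.symm
    -- The factor `h(σ)` is supported in the half-tree `B` opposite to the axis edge that it fixes.
    have hs := h₀_mem_rist (S := S) (ι := ι) (letterPerm_mulSingle s (units_ne_neg δ).symm :
      letterPerm S (Pi.mulSingle (-δ) s) (axisLetter ι (-δ)) = axisLetter ι (-δ))
    have ht := conj_mem_rist (h₀_mem_rist (S := S) (ι := ι)
      (letterPerm_mulSingle t (units_ne_neg δ').symm :
      letterPerm S (Pi.mulSingle (-δ') t) (axisLetter ι (-δ')) = axisLetter ι (-δ'))) (τ ι S ^ m)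
    have hB : IsHalfTree S (branch ι (axisLetter ι (-δ)))ᶜ := (isHalfTree_branch _).compl
    have hC : IsHalfTree S (τ ι S ^ m • (branch ι (axisLetter ι (-δ')))ᶜ) :=
      (isHalfTree_branch _).compl.smul _
    rcases Int.units_eq_one_or (δ' * δ) with h | h
    · -- The supports are nested.
      obtain rfl : δ' = δ := by
        rw [← mul_one δ', ← Int.units_mul_self δ, ← mul_assoc, h, one_mul]
      rcases le_total 0 ((δ' : ℤ) * m) with hm | hm
      · refine hB.commute_modRistComm hI hs (rist_mono ?_ ht)
        rw [hτ, smul_smul, ← zpow_add, add_comm, zpow_add, mul_smul]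
        exact Set.smul_set_mono (τ_zpow_smul_branch_subset hm)
      · refine hC.commute_modRistComm hI (rist_mono ?_ hs) ht
        rw [Set.subset_smul_set_iff, hτ, ← zpow_neg, smul_smul, ← zpow_add, add_comm, zpow_add,
          mul_smul]
        exact Set.smul_set_mono (τ_zpow_smul_branch_subset (by rw [mul_neg]; linarith))
    · obtain rfl : δ' = -δ := by
        rw [← mul_one δ', ← Int.units_mul_self δ, ← mul_assoc, h, neg_one_mul]
      have hC' : τ ι S ^ m • (branch ι (axisLetter ι (- -δ)))ᶜ =
          τ ι S ^ (m + δ) • branch ι (axisLetter ι (-δ)) := by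
        rw [hτ, smul_smul, ← zpow_add, Units.val_neg, neg_neg]
      rcases le_or_gt 0 ((δ : ℤ) * (m + δ)) with hm | hm
      · -- The supports cover the tree.
        refine hB.commute_modRistComm_of_compl_subset hI hC ?_ hs ht
        rw [compl_compl, hC', Set.subset_smul_set_iff, ← zpow_neg]
        refine τ_zpow_smul_branch_subset ?_
        rw [Units.val_neg]
        linarith
      · -- The supports do not meet a branch which leaves the axis between them.
        obtain ⟨b, hb, hbne⟩ := exists_letter_ne hI δ
        have hbne' : b ≠ axisLetter ι (-δ) := fun h =>
          units_ne_neg δ (hb.symm.trans (congrArg Sigma.fst h))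
        have hE : IsHalfTree S (τ ι S ^ (-(δ : ℤ)) • (branch ι b)ᶜ) :=
          (isHalfTree_branch b).compl.smul _
        have hδ : (δ : ℤ) * δ = 1 := by rw [← Units.val_mul, Int.units_mul_self, Units.val_one]
        refine hE.commute_modRistComm hI (rist_mono ?_ hs) (rist_mono ?_ ht)
        · rw [hτ]
          exact Set.smul_set_mono (branch_subset_compl hbne.symm)
        · rw [hC', Set.subset_smul_set_iff, ← zpow_neg, smul_smul, ← zpow_add]
          refine (τ_zpow_smul_branch_subset ?_).trans (branch_subset_compl hbne'.symm)
          rw [Units.val_neg]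
          linarith

/-! ### The kernel of `η` -/

/-- The kernel of `η` is generated by commutators of elements with support in a common half-tree:
modulo `ristComm`, the conjugates of the `h(σ)` by powers of `τ` generate an abelian group, and so
the quotient map factors through the wreath product. -/
theorem ker_eta_le_ristComm (hI : ∀ ε, ∃ i : I ε, i ≠ ι ε) :
    (eta ι S).ker ≤ ristComm ι S := by
  obtain ⟨ψ, hψ, hψτ⟩ := Wreath.exists_hom_of_commute (modRistComm.comp (h₀Hom ι S))
    (modRistComm (τ ι S)) (fun m σ ρ => by
      have := commute_modRistComm_h₀ hI σ ρ m
      rwa [map_mul, map_mul, map_inv, map_zpow] at this)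
  have hfac : ψ.comp (eta ι S) = modRistComm := by
    refine MonoidHom.eq_of_eqOn_dense closure_τ_h₀ ?_
    rintro _ (rfl | ⟨σ, rfl⟩)
    · rw [MonoidHom.comp_apply, eta_τ, hψτ]
    · rw [MonoidHom.comp_apply, eta_h₀, hψ, MonoidHom.comp_apply, h₀Hom_apply]
  intro g hg
  rw [← QuotientGroup.eq_one_iff]
  change modRistComm g = 1
  rw [← hfac, MonoidHom.comp_apply, MonoidHom.mem_ker.1 hg, map_one]

theorem ker_eta_eq_ristComm (hI : ∀ ε, ∃ i : I ε, i ≠ ι ε) : (eta ι S).ker = ristComm ι S :=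
  (ker_eta_le_ristComm hI).antisymm ristComm_le_ker

end Commutators

section Simplicity

open scoped Pointwise commutatorElement

variable {I : ℤˣ → Type u} {ι : ∀ ε, I ε} {S : ∀ ε, Subgroup (Equiv.Perm (I ε))}
  [∀ ε, MulAction.IsPretransitive (S ε) (I ε)]

/-! ### Simplicity -/

/-- If `n` moves `B` off itself, then the commutator of two elements `a`, `b` with support in `B`
equals `⁅⁅n, a⁻¹⁆, b⁆`, because `n a⁻¹ n⁻¹` commutes with `a` and `b`. -/
theorem commutator_eq_of_disjoint_smul {B : Set (Vertex ι)} {n a b : Lam ι S}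
    (hn : Disjoint B (n • B)) (ha : a ∈ rist S B) (hb : b ∈ rist S B) :
    ⁅⁅n, a⁻¹⁆, b⁆ = ⁅a, b⁆ := by
  have hk := conj_mem_rist (inv_mem ha) n
  have hka : Commute a (n * a⁻¹ * n⁻¹) := commute_of_mem_rist hn ha hk
  have hkb : Commute b (n * a⁻¹ * n⁻¹) := commute_of_mem_rist hn hb hk
  have h₁ : ⁅n, a⁻¹⁆ = a * (n * a⁻¹ * n⁻¹)⁻¹⁻¹ := by
    rw [inv_inv, hka.eq, commutatorElement_def, inv_inv]
  have h₂ := commutatorElement_mul_inv_mul_inv (a := a) (b := b) (c := (n * a⁻¹ * n⁻¹)⁻¹) (d := 1)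
    hkb.symm.inv_left (Commute.one_right _) (Commute.one_left _)
  rw [inv_one, mul_one] at h₂
  rw [h₁, h₂]

/-- A non-trivial subgroup which is normalized by the kernel of `η` contains the subgroup
`ristComm`. -/
theorem ristComm_le_of_normalized (hI : ∀ ε, ∃ i : I ε, i ≠ ι ε) {N : Subgroup (Lam ι S)}
    (hN : ∀ g ∈ (eta ι S).ker, ∀ x ∈ N, g * x * g⁻¹ ∈ N) {n : Lam ι S} (hn : n ∈ N)
    (hn₁ : n ≠ 1) : ristComm ι S ≤ N := by
  obtain ⟨B, hB, hdisj⟩ := exists_isHalfTree_disjoint_smul hI hn₁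
  refine (Subgroup.closure_le _).2 ?_
  rintro _ ⟨C, hC, a, ha, b, hb, rfl⟩
  -- Move `C` into `B` by an element `g` of the kernel.
  obtain ⟨g, hg, hgC⟩ := hC.exists_mem_ker_smul_subset hI hB
  have conj_ker : ∀ x ∈ (eta ι S).ker, g * x * g⁻¹ ∈ (eta ι S).ker := fun x hx =>
    mul_mem (mul_mem hg hx) (inv_mem hg)
  have key : ⁅g * a * g⁻¹, g * b * g⁻¹⁆ ∈ N := by
    rw [← commutator_eq_of_disjoint_smul hdisj (rist_mono hgC (conj_mem_rist ha.1 g))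
      (rist_mono hgC (conj_mem_rist hb.1 g))]
    have h₁ : ⁅n, (g * a * g⁻¹)⁻¹⁆ ∈ N := by
      have := mul_mem hn (hN _ (inv_mem (conj_ker a ha.2)) _ (inv_mem hn))
      rwa [← mul_assoc, ← mul_assoc, ← commutatorElement_def] at this
    have := mul_mem h₁ (hN _ (conj_ker b hb.2) _ (inv_mem h₁))
    rwa [← mul_assoc, ← mul_assoc, ← commutatorElement_def] at this
  rw [SetLike.mem_coe]
  have := hN _ (inv_mem hg) _ key
  rw [← MulAut.conj_apply, map_commutatorElement, MulAut.conj_apply, MulAut.conj_apply] at this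
  convert this using 2 <;> group

theorem isSimpleGroup_ker_eta (hI : ∀ ε, ∃ i : I ε, i ≠ ι ε) : IsSimpleGroup (eta ι S).ker := by
  have hnontriv : Nontrivial (eta ι S).ker := by
    obtain ⟨g, hg, hsub⟩ := (isHalfTree_branch (S := S)
      (axisLetter ι 1)).exists_mem_ker_smul_subset hI (isHalfTree_branch (axisLetter ι (-1)))
    refine ⟨⟨⟨g, hg⟩, 1, fun h => ?_⟩⟩
    obtain rfl : g = 1 := congrArg Subtype.val h
    rw [one_smul] at hsub
    have hmem : (⟨[axisLetter ι 1], admissible_singleton _⟩ : Vertex ι) ∈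
        branch ι (axisLetter ι 1) := rfl
    exact Set.disjoint_left.1 (disjoint_branch (axisLetter_neg_ne ι 1)) (hsub hmem) hmem
  refine { hnontriv with
    eq_bot_or_eq_top_of_normal := fun H hH => or_iff_not_imp_left.2 fun hbot => ?_ }
  obtain ⟨n, hn, hn₁⟩ := (Subgroup.bot_or_exists_ne_one H).resolve_left hbot
  have hle := ristComm_le_of_normalized hI (N := H.map (eta ι S).ker.subtype) (by
    rintro g hg _ ⟨x, hx, rfl⟩
    exact ⟨_, hH.conj_mem x hx ⟨g, hg⟩, rfl⟩) (Subgroup.mem_map_of_mem _ hn)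
    (fun h => hn₁ (Subtype.ext h))
  rw [← ker_eta_eq_ristComm hI] at hle
  refine eq_top_iff.2 fun x _ => ?_
  obtain ⟨y, hy, hyx⟩ := hle x.2
  obtain rfl : y = x := Subtype.ext hyx
  exact hy

end Simplicity

end TreeHNN

theorem mainTheorem4 {I : ℤˣ → Type u} (ι : ∀ ε, I ε)
    (S : ∀ ε, Subgroup (Equiv.Perm (I ε)))
    (hI : ∀ ε, ∃ i : I ε, i ≠ ι ε)
    (htrans : ∀ ε, MulAction.IsPretransitive (S ε) (I ε))
    (h2trans : ∀ ε, ∀ i x y : I ε, x ≠ i → y ≠ i → ∃ σ : S ε, σ • i = i ∧ σ • x = y)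
    (hgen : ∀ ε, Subgroup.closure {σ : S ε | ∃ i : I ε, σ • i = i} = ⊤ ∨
      (Nat.card (I ε) = 2 ∧ S ε = ⊤)) :
    ∃ Ξ : Subgroup (TreeHNN.Lam ι S), Ξ.Normal ∧ IsSimpleGroup Ξ ∧
      ∃ η : TreeHNN.Lam ι S →* TreeHNN.Wreath (Abelianization (TreeHNN.Gam S)),
        Function.Surjective η ∧ η.ker = Ξ ∧
        (∀ σ : TreeHNN.Gam S,
          η (TreeHNN.h₀ ι S σ) = TreeHNN.Wreath.lamp 0 (Abelianization.of σ)) ∧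
        η (TreeHNN.τ ι S) = TreeHNN.Wreath.gen (Abelianization (TreeHNN.Gam S)) ∧
        ∀ x : TreeHNN.Symb ι S, x.word ≠ [] →
          η (TreeHNN.h ι S x) =
            TreeHNN.Wreath.lamp (TreeHNN.height x.word) (Abelianization.of x.perm) :=
  ⟨(TreeHNN.eta ι S).ker, inferInstance, TreeHNN.isSimpleGroup_ker_eta hI, TreeHNN.eta ι S,
    TreeHNN.eta_surjective, rfl, TreeHNN.eta_h₀, TreeHNN.eta_τ, fun x _ => TreeHNN.eta_h x⟩
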